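/- Let $d\ge 2$, let $U$ be a $d\times d$ unitary matrix with columns $u_1,\dots,u_d$, and let $\delta\in[0,1]$. Write $\mathcal P_U(\rho)=\sum_{i=1}^d\langle u_i|\rho|u_i\rangle\,|i\rangle\langle i|$ for the von Neumann measurement given by $U$, viewed as a channel, and $\mathcal{DU}_d$ for the set of diagonal unitary $d\times d$ matrices. For a $d\times d$ matrix $X$ and $q\in[0,1]$ put $$W_q(X)=\{\langle\psi|X|\varphi\rangle:\ \langle\psi|\psi\rangle=\langle\varphi|\varphi\rangle=1,\ \langle\psi|\varphi\rangle=q\},\qquad \nu_q(X)=\min\{|x|:x\in W_q(X)\},\qquad \nu(X)=\nu_1(X).$$ Consider the single-shot certification of $H_0:\mathcal P_{1}\otimes 1$ against $H_1:\mathcal P_U\otimes 1$. A strategy consists of a unit vector $\psi\in\mathbb C^d\otimes\mathbb C^k$ ($k$ arbitrary) and an effect $0\le\Omega\le 1$ on $\mathbb C^d\otimes\mathbb C^k$, where $\Omega$ accepts $H_0$; it is admissible if its type I error satisfies $\operatorname{tr}\big((1-\Omega)(\mathcal P_{1}\otimes 1)(|\psi\rangle\langle\psi|)\big)\le\delta$.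 Let $p_{\mathrm{II}}$ be the minimum of the type II error $\operatorname{tr}\big(\Omega(\mathcal P_U\otimes 1)(|\psi\rangle\langle\psi|)\big)$ over all admissible strategies; an admissible strategy attaining it is called optimal. **Theorem.** For every $E\in\mathcal{DU}_d$ the minima $\nu_{\sqrt{1-\delta}}(UE)$ and $\nu(UE)$ exist, the minimum $p_{\mathrm{II}}$ is attained, the maximum below is attained, and $$p_{\mathrm{II}}=\max_{E\in\mathcal{DU}_d}\nu^2_{\sqrt{1-\delta}}(UE).$$ Moreover, the following strategies are optimal. 1. If $\nu(UE)=0$ for all $E\in\mathcal{DU}_d$, there is a unit vector $\psi_0\in\mathbb C^d\otimes\mathbb C^d$ for which $(\mathcal P_1\otimes 1)(|\psi_0\rangle\langle\psi_0|)$ and $(\mathcal P_U\otimes 1)(|\psi_0\rangle\langle\psi_0|)$ have product zero. For every such $\psi_0$, the pair $(\psi_0,\Omega_0)$ is optimal, where $\Omega_0$ is the orthogonal projection onto the support of $(\mathcal P_1\otimes 1)(|\psi_0\rangle\langle\psi_0|)$. 2. Otherwise let $E_0\in\mathcal{DU}_d$ maximize $\nu(UE)$ over $E \in \mathcal{DU}_d$,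 so that $\nu(UE_0)>0$, and let $\lambda_1,\lambda_d$ be a pair of most distant eigenvalues of $UE_0$. There are density matrices $\rho_1,\rho_2$ supported on the eigenspaces of $UE_0$ for $\lambda_1$ and $\lambda_d$, respectively, with $\langle i|\rho_1|i\rangle=\langle i|\rho_2|i\rangle$ for all $i$. For every such pair put $\rho_0=\frac12(\rho_1+\rho_2)$ and $|\psi_0\rangle=\sum_{i=1}^d\sqrt{\rho_0}\,|i\rangle\otimes|i\rangle$. If $\langle i|\rho_0|i\rangle\ne0$, there is an effect $\Omega_i$ that minimizes $$\operatorname{tr}\Big(\Omega\,\frac{\sqrt{\rho_0}\,U|i\rangle\langle i|U^\dagger\sqrt{\rho_0}}{\langle i|\rho_0|i\rangle}\Big)\quad\text{over effects }\Omega\text{ on }\mathbb C^d\text{ with}\quad \operatorname{tr}\Big((1-\Omega)\,\frac{\sqrt{\rho_0}\,|i\rangle\langle i|\sqrt{\rho_0}}{\langle i|\rho_0|i\rangle}\Big)\le\delta;$$ put $\Omega_i=0$ if $\langle i|\rho_0|i\rangle=0$. For every choice of such $\Omega_i$, the pair $(\psi_0,\Omega_0)$ with $\Omega_0=\sum_{i=1}^d|i\rangle\langle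 i|\otimes\Omega_i^{\top}$ is optimal. -/

import Mathlib

open scoped Matrix Kronecker ComplexOrder

namespace QuantumCertification

variable {n m : Type*} [Fintype n] [DecidableEq n] [Fintype m] [DecidableEq m]

/-- A vector of norm one (a pure state `|ψ⟩`). -/
def IsUnitVec (ψ : n → ℂ) : Prop := star ψ ⬝ᵥ ψ = 1

/-- The density matrix `|ψ⟩⟨ψ|`. -/
def proj (ψ : n → ℂ) : Matrix n n ℂ := Matrix.vecMulVec ψ (star ψ)

/-- A quantum state: a positive semidefinite matrix of trace one. -/
def IsDensity (ρ : Matrix n n ℂ) : Prop := ρ.PosSemidef ∧ ρ.trace = 1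

/-- An effect, `0 ≤ Ω ≤ 1`; it stands for the binary measurement `{Ω, 1 - Ω}`, whose first
outcome accepts the null hypothesis. -/
def IsEffect (Ω : Matrix n n ℂ) : Prop := Ω.PosSemidef ∧ (1 - Ω).PosSemidef

/-- The von Neumann measurement `P_U` as the measure-and-prepare channel
`ρ ↦ ∑ i, ⟨u_i|ρ|u_i⟩ |i⟩⟨i|`, where `u_i` is the `i`-th column of `U`. -/
noncomputable def vonNeumann (U : Matrix n n ℂ) : Matrix n n ℂ →ₗ[ℂ] Matrix n n ℂ where
  toFun ρ := ∑ i, (star (U.col i) ⬝ᵥ (ρ *ᵥ U.col i)) • Matrix.single i i (1 : ℂ)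
  map_add' ρ σ := by
    simp [Matrix.add_mulVec, dotProduct_add, add_smul, Finset.sum_add_distrib]
  map_smul' c ρ := by
    simp [Matrix.smul_mulVec, dotProduct_smul, Finset.smul_sum]

/-- The extension `Ψ ⊗ 1` of a superoperator `Ψ` by the identity on an auxiliary system
indexed by `m`: the map `Ψ` acts on the first tensor factor. -/
def extend (Ψ : Matrix n n ℂ →ₗ[ℂ] Matrix n n ℂ) (X : Matrix (n × m) (n × m) ℂ) :
    Matrix (n × m) (n × m) ℂ :=
  Matrix.of fun x y => Ψ (Matrix.of fun i j => X (i, x.2) (j, y.2)) x.1 y.1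

/-- Probability of rejecting the state `σ` by the measurement `{Ω, 1 - Ω}`. -/
noncomputable def rejectProb (Ω σ : Matrix n n ℂ) : ℝ := ((1 - Ω) * σ).trace.re

/-- Probability of accepting the state `σ` by the measurement `{Ω, 1 - Ω}`. -/
noncomputable def acceptProb (Ω σ : Matrix n n ℂ) : ℝ := (Ω * σ).trace.re

/-- Type I error for the null hypothesis `Φ₀ ⊗ 1`, with input state `ψ` and measurement `Ω`. -/
noncomputable def typeIError (Φ₀ : Matrix n n ℂ →ₗ[ℂ] Matrix n n ℂ)
    (ψ : n × m → ℂ) (Ω : Matrix (n × m) (n × m) ℂ) : ℝ :=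
  rejectProb Ω (extend Φ₀ (proj ψ))

/-- Type II error for the alternative hypothesis `Φ₁ ⊗ 1`, with input state `ψ` and
measurement `Ω`. -/
noncomputable def typeIIError (Φ₁ : Matrix n n ℂ →ₗ[ℂ] Matrix n n ℂ)
    (ψ : n × m → ℂ) (Ω : Matrix (n × m) (n × m) ℂ) : ℝ :=
  acceptProb Ω (extend Φ₁ (proj ψ))

/-- An admissible strategy at significance `δ`: a (possibly entangled) pure input state and a
binary measurement on the output whose type I error is at most `δ`. -/
def IsStrategy (Φ₀ : Matrix n n ℂ →ₗ[ℂ] Matrix n n ℂ) (δ : ℝ)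
    (ψ : n × m → ℂ) (Ω : Matrix (n × m) (n × m) ℂ) : Prop :=
  IsUnitVec ψ ∧ IsEffect Ω ∧ typeIError Φ₀ ψ Ω ≤ δ

/-- All type II errors of admissible strategies for `H₀ : Φ₀ ⊗ 1` against `H₁ : Φ₁ ⊗ 1`, over
auxiliary systems of all finite dimensions. -/
def achievableErrors (Φ₀ Φ₁ : Matrix n n ℂ →ₗ[ℂ] Matrix n n ℂ) (δ : ℝ) : Set ℝ :=
  {p | ∃ (k : ℕ) (ψ : n × Fin k → ℂ) (Ω : Matrix (n × Fin k) (n × Fin k) ℂ),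
    IsStrategy Φ₀ δ ψ Ω ∧ p = typeIIError Φ₁ ψ Ω}

/-- The minimized probability `p_II` of the type II error. -/
noncomputable def minTypeII (Φ₀ Φ₁ : Matrix n n ℂ →ₗ[ℂ] Matrix n n ℂ) (δ : ℝ) : ℝ :=
  sInf (achievableErrors Φ₀ Φ₁ δ)

/-- An optimal strategy: admissible, with the least type II error among all admissible
strategies. -/
def IsOptimalStrategy (Φ₀ Φ₁ : Matrix n n ℂ →ₗ[ℂ] Matrix n n ℂ) (δ : ℝ)
    (ψ : n × m → ℂ) (Ω : Matrix (n × m) (n × m) ℂ) : Prop :=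
  IsStrategy Φ₀ δ ψ Ω ∧ ∀ p ∈ achievableErrors Φ₀ Φ₁ δ, typeIIError Φ₁ ψ Ω ≤ p

/-- The `q`-numerical range `W_q(X)`; the numerical range is `W_1(X)`. -/
def qNumericalRange (q : ℂ) (X : Matrix n n ℂ) : Set ℂ :=
  {z | ∃ ψ φ : n → ℂ, IsUnitVec ψ ∧ IsUnitVec φ ∧ star ψ ⬝ᵥ φ = q ∧ z = star ψ ⬝ᵥ (X *ᵥ φ)}

/-- The distance `ν_q(X)` from `0` to the `q`-numerical range of `X`. -/
noncomputable def nu (q : ℂ) (X : Matrix n n ℂ) : ℝ :=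
  sInf ((fun z : ℂ => ‖z‖) '' qNumericalRange q X)

variable (n) in
/-- The diagonal unitary matrices. -/
def diagonalUnitaries : Set (Matrix n n ℂ) :=
  {E | E ∈ Matrix.unitaryGroup n ℂ ∧ E.IsDiag}

/-- `Ω` is the orthogonal projection onto the support (the range) of `σ`. -/
def IsSupportProjection (σ Ω : Matrix n n ℂ) : Prop :=
  Ω.IsHermitian ∧ Ω * Ω = Ω ∧ LinearMap.range Ω.mulVecLin = LinearMap.range σ.mulVecLin

/-- `Ω` is a most powerful test, at significance `δ`, of the state `σ` against the state `τ`. -/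
def IsMostPowerful (δ : ℝ) (σ τ Ω : Matrix n n ℂ) : Prop :=
  (IsEffect Ω ∧ rejectProb Ω σ ≤ δ) ∧
    ∀ Ω' : Matrix n n ℂ, IsEffect Ω' → rejectProb Ω' σ ≤ δ → acceptProb Ω τ ≤ acceptProb Ω' τ

/-- `a`, `b` is a pair of most distant eigenvalues of `V`. -/
def IsMostDistantPair (V : Matrix n n ℂ) (a b : ℂ) : Prop :=
  a ∈ spectrum ℂ V ∧ b ∈ spectrum ℂ V ∧
    ∀ x ∈ spectrum ℂ V, ∀ y ∈ spectrum ℂ V, ‖x - y‖ ≤ ‖a - b‖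

/-- States `ρ₁`, `ρ₂` supported on the eigenspaces of `V` for the eigenvalues `a` and `b`,
with the same diagonal. -/
def IsDiscriminatorPair (V : Matrix n n ℂ) (a b : ℂ) (ρ₁ ρ₂ : Matrix n n ℂ) : Prop :=
  IsDensity ρ₁ ∧ IsDensity ρ₂ ∧ V * ρ₁ = a • ρ₁ ∧ V * ρ₂ = b • ρ₂ ∧ ρ₁.diag = ρ₂.diag

/-- The input state `∑ i, S|i⟩ ⊗ |i⟩`. -/
def inputState (S : Matrix n n ℂ) : n × n → ℂ := fun x => S x.1 x.2

/-- The family of tests conditioned on the label `i`: with `S = √ρ`, the effect `Ω i` is a most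
powerful test of the state `S|i⟩⟨i|S / ⟨i|ρ|i⟩` against `S U|i⟩⟨i|U† S / ⟨i|ρ|i⟩` if
`⟨i|ρ|i⟩ ≠ 0`, and `Ω i = 0` otherwise. -/
def IsConditionalTest (U : Matrix n n ℂ) (δ : ℝ) (ρ S : Matrix n n ℂ)
    (Ω : n → Matrix n n ℂ) : Prop :=
  ∀ i, (ρ i i ≠ 0 → IsMostPowerful δ ((ρ i i)⁻¹ • proj (S.col i))
      ((ρ i i)⁻¹ • proj ((S * U).col i)) (Ω i)) ∧
    (ρ i i = 0 → Ω i = 0)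

/-- The measurement `∑ i, |i⟩⟨i| ⊗ (Ω i)ᵀ`. -/
def labelledMeasurement (Ω : n → Matrix n n ℂ) : Matrix (n × n) (n × n) ℂ :=
  ∑ i, Matrix.single i i (1 : ℂ) ⊗ₖ (Ω i)ᵀ

end QuantumCertification

open QuantumCertification

/-!
Rotating by `U† ⊗ 1` and dephasing the first factor implements `P_U ⊗ 1`, and dephasing can be moved
onto the effect. So a strategy `(ψ, Ω)` tests the pure states `ψ` and `(U† ⊗ 1)ψ` with a
block-diagonal effect; multiplying the columns of `U` by phases changes nothing, so `U` may be
replaced by any `UE` with `E` a diagonal unitary.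

*Two pure states.* An effect that accepts `y` with probability at least `q²` accepts `x` with
probability at least `tradeoff q |⟨x|y⟩| ^ 2`, where `tradeoff (cos α) (cos θ)` is `cos (α + θ)` cut
off at `0` (`tradeoff_sq_le_of_isEffect`), and a rank-one projection attains this bound
(`exists_isUnitVec_tradeoff`). For a unitary `V` the same function gives
`ν_q(V) = tradeoff q (ν(V))` (`isLeast_tradeoff_nu`). Since the overlap of `ψ` and `(V† ⊗ 1)ψ` has
the form `tr ρV†`, and the numerical range of a unitary matrix is the convex hull of its
eigenvalues, this overlap is at least `ν(V)`. With `V = UE` this is the lower bound on the type II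
error (`tradeoff_sq_le_typeIIError`). As `tradeoff` is monotone, the best bound comes from an `E₀`
that maximizes `ν(UE)`.

*Minimax.* There is a state `ρ` with `∑ i, |⟨i|ρU|i⟩| ≤ max_E ν(UE)`
(`exists_isDensity_sum_norm_le`), by separating convex sets and taking the phases of the separating
functional for `E`. If the maximum is `0`, the purification of `ρ` has orthogonal outputs. If it is
`c > 0`, put `V = UE₀`. After multiplication by a phase, the spectrum of `V` lies on the arc
`c ≤ Re z` of the unit circle, and the most distant eigenvalues are its endpoints `c ± iσ`. From
`|tr ρV| ≥ c ≥ ∑ i, |⟨i|ρV|i⟩|` it follows that `⟨i|ρV|i⟩` is real and nonnegative for all `i`, and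
that `ρ` lives on the eigenspaces of the two endpoints; its parts there have the same diagonal
(`exists_split_of_real_diag`, `exists_isDiscriminatorPair`).

*Attainment.* For a discriminator pair and `ρ₀ = (ρ₁ + ρ₂) / 2`, the states conditioned on each
label `i` have overlap of modulus exactly `c` (`conditional_states`), so most powerful tests reach
`tradeoff √(1-δ) c ^ 2` on every label (`isStrategy_labelledMeasurement`).
-/

namespace QuantumCertification

set_option linter.unusedSectionVars false

variable {n m : Type*} [Fintype n] [DecidableEq n] [Fintype m] [DecidableEq m]

/-! ### Vectors and positive semidefinite forms -/

lemma star_dotProduct_eq_inner (u v : n → ℂ) :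
    star u ⬝ᵥ v = inner ℂ (WithLp.toLp 2 u) (WithLp.toLp 2 v) := by
  rw [EuclideanSpace.inner_toLp_toLp, dotProduct_comm]

lemma star_dotProduct_self_eq_norm_sq (u : n → ℂ) :
    star u ⬝ᵥ u = ((‖WithLp.toLp 2 u‖ ^ 2 : ℝ) : ℂ) := by
  rw [star_dotProduct_eq_inner, inner_self_eq_norm_sq_to_K]
  simp

lemma IsUnitVec.norm_toLp {u : n → ℂ} (hu : IsUnitVec u) : ‖WithLp.toLp 2 u‖ = 1 := by
  have h := star_dotProduct_self_eq_norm_sq u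
  rw [show star u ⬝ᵥ u = 1 from hu] at h
  have h2 : ‖WithLp.toLp 2 u‖ ^ 2 = 1 := by exact_mod_cast h.symm
  exact (pow_eq_one_iff_of_nonneg (norm_nonneg _) two_ne_zero).1 h2

lemma isUnitVec_iff_norm_toLp (u : n → ℂ) : IsUnitVec u ↔ ‖WithLp.toLp 2 u‖ = 1 :=
  ⟨IsUnitVec.norm_toLp, fun h => by
    rw [IsUnitVec, star_dotProduct_self_eq_norm_sq, h]; simp⟩

lemma conj_star_dotProduct (u v : n → ℂ) : star (star u ⬝ᵥ v) = star v ⬝ᵥ u := by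
  rw [Matrix.star_dotProduct, star_star, dotProduct_comm]

lemma norm_star_dotProduct_comm (u v : n → ℂ) : ‖star u ⬝ᵥ v‖ = ‖star v ⬝ᵥ u‖ := by
  rw [← conj_star_dotProduct u v, norm_star]

/-- The Cauchy–Schwarz inequality. -/
lemma norm_star_dotProduct_le (u v : n → ℂ) :
    ‖star u ⬝ᵥ v‖ ≤ √(star u ⬝ᵥ u).re * √(star v ⬝ᵥ v).re := by
  rw [star_dotProduct_self_eq_norm_sq, star_dotProduct_self_eq_norm_sq, star_dotProduct_eq_inner,
    Complex.ofReal_re, Complex.ofReal_re, Real.sqrt_sq (norm_nonneg _),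
    Real.sqrt_sq (norm_nonneg _)]
  exact norm_inner_le_norm _ _

lemma IsUnitVec.norm_star_dotProduct_le_one {u v : n → ℂ} (hu : IsUnitVec u) (hv : IsUnitVec v) :
    ‖star u ⬝ᵥ v‖ ≤ 1 := by
  have h := norm_star_dotProduct_le u v
  rw [show star u ⬝ᵥ u = 1 from hu, show star v ⬝ᵥ v = 1 from hv] at h
  simpa using h

lemma star_dotProduct_mul_mulVec (A B : Matrix n n ℂ) (u v : n → ℂ) :
    star u ⬝ᵥ ((A * B) *ᵥ v) = star (Aᴴ *ᵥ u) ⬝ᵥ (B *ᵥ v) := by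
  rw [← Matrix.mulVec_mulVec, Matrix.dotProduct_mulVec, Matrix.star_mulVec,
    Matrix.conjTranspose_conjTranspose]

lemma star_dotProduct_mulVec (A : Matrix n n ℂ) (u v : n → ℂ) :
    star u ⬝ᵥ (A *ᵥ v) = star (Aᴴ *ᵥ u) ⬝ᵥ v := by
  rw [Matrix.dotProduct_mulVec, Matrix.star_mulVec, Matrix.conjTranspose_conjTranspose]

open scoped MatrixOrder in
lemma exists_posSemidef_mul_self {D : Matrix n n ℂ} (hD : D.PosSemidef) :
    ∃ S : Matrix n n ℂ, S.PosSemidef ∧ S * S = D :=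
  ⟨CFC.sqrt D, Matrix.nonneg_iff_posSemidef.1 (CFC.sqrt_nonneg D),
    CFC.sqrt_mul_sqrt_self D hD.nonneg⟩

/-- The Cauchy–Schwarz inequality for a positive semidefinite form. -/
lemma norm_star_dotProduct_mulVec_le {D : Matrix n n ℂ} (hD : D.PosSemidef) (u v : n → ℂ) :
    ‖star u ⬝ᵥ (D *ᵥ v)‖ ≤ √(star u ⬝ᵥ (D *ᵥ u)).re * √(star v ⬝ᵥ (D *ᵥ v)).re := by
  obtain ⟨S, hS, rfl⟩ := exists_posSemidef_mul_self hD
  simp only [star_dotProduct_mul_mulVec, hS.1.eq]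
  exact norm_star_dotProduct_le _ _

lemma IsUnitVec.mulVec {V : Matrix n n ℂ} (hV : V ∈ Matrix.unitaryGroup n ℂ) {u : n → ℂ}
    (hu : IsUnitVec u) : IsUnitVec (V *ᵥ u) := by
  have h := star_dotProduct_mul_mulVec Vᴴ V u u
  rw [← Matrix.star_eq_conjTranspose, Matrix.mem_unitaryGroup_iff'.1 hV, Matrix.one_mulVec,
    Matrix.star_eq_conjTranspose, Matrix.conjTranspose_conjTranspose] at h
  rw [IsUnitVec, ← h]
  exact hu

/-! ### The trade-off between two pure states -/

/-- The modulus of the amplitude with which a test must accept a pure state `x`, given that it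
accepts a pure state `y` with amplitude of modulus `q`, where `c` is the modulus of the overlap of
`x` and `y`: writing `q = cos α` and `c = cos θ`, it is `cos (α + θ)`, cut off at `0`. -/
noncomputable def tradeoff (q c : ℝ) : ℝ := max 0 (q * c - √(1 - q ^ 2) * √(1 - c ^ 2))

lemma tradeoff_nonneg (q c : ℝ) : 0 ≤ tradeoff q c := le_max_left _ _

lemma tradeoff_mono {q : ℝ} (hq : 0 ≤ q) {c c' : ℝ} (hc : 0 ≤ c) (h : c ≤ c') :
    tradeoff q c ≤ tradeoff q c' := by
  unfold tradeoff
  gcongr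

/-- The angle inequality behind `tradeoff`: if `cos θ ≤ cos (a - b)` and `b ≤ α`, then
`cos (α + θ) ≤ cos a`. -/
lemma tradeoff_le_of_le {q c s t : ℝ} (hq : 0 ≤ q) (hc : 0 ≤ c) (hc1 : c ≤ 1) (hs : 0 ≤ s)
    (hs1 : s ≤ 1) (hqt : q ≤ t) (ht1 : t ≤ 1)
    (h : c ≤ s * t + √(1 - s ^ 2) * √(1 - t ^ 2)) : tradeoff q c ≤ s := by
  refine max_le hs ?_
  have half : ∀ x : ℝ, 0 ≤ x → Real.arccos x ≤ Real.pi / 2 :=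
    fun x hx => Real.arccos_le_pi_div_two.2 hx
  have hcos : ∀ x : ℝ, 0 ≤ x → x ≤ 1 → Real.cos (Real.arccos x) = x :=
    fun x hx hx1 => Real.cos_arccos (by linarith) hx1
  have h1 : c ≤ Real.cos |Real.arccos s - Real.arccos t| := by
    rw [Real.cos_abs, Real.cos_sub, hcos s hs hs1, hcos t (by linarith) ht1, Real.sin_arccos,
      Real.sin_arccos]
    exact h
  have h2 : |Real.arccos s - Real.arccos t| ≤ Real.arccos c := by
    have h3 : |Real.arccos s - Real.arccos t| ≤ Real.pi := by
      rw [abs_le]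
      constructor <;> linarith [half s hs, half t (by linarith), Real.arccos_nonneg s,
        Real.arccos_nonneg t, Real.pi_pos]
    rw [← Real.arccos_cos (abs_nonneg _) h3]
    exact Real.antitone_arccos h1
  have h4 : Real.arccos t ≤ Real.arccos q := Real.antitone_arccos hqt
  have h5 : Real.arccos s ≤ Real.arccos q + Real.arccos c := by
    linarith [le_abs_self (Real.arccos s - Real.arccos t)]
  have h6 : Real.cos (Real.arccos q + Real.arccos c) ≤ Real.cos (Real.arccos s) :=
    Real.cos_le_cos_of_nonneg_of_le_pi (Real.arccos_nonneg s)
      (by linarith [half q hq, half c hc]) h5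
  rwa [Real.cos_add, hcos q hq (by linarith), hcos c hc hc1, hcos s hs hs1, Real.sin_arccos,
    Real.sin_arccos] at h6

/-- An effect which accepts `y` with probability at least `q²` accepts `x` with probability at
least `tradeoff q |⟨x|y⟩| ^ 2`: split `⟨x|y⟩` along the effect and its complement, and apply the
Cauchy–Schwarz inequality to both parts. -/
lemma tradeoff_sq_le_of_isEffect {D : Matrix n n ℂ} (hD : IsEffect D) {x y : n → ℂ}
    (hx : IsUnitVec x) (hy : IsUnitVec y) {q : ℝ} (hq : 0 ≤ q)
    (h : q ^ 2 ≤ (star y ⬝ᵥ (D *ᵥ y)).re) :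
    tradeoff q ‖star x ⬝ᵥ y‖ ^ 2 ≤ (star x ⬝ᵥ (D *ᵥ x)).re := by
  have compl : ∀ u v : n → ℂ,
      star u ⬝ᵥ ((1 - D) *ᵥ v) = star u ⬝ᵥ v - star u ⬝ᵥ (D *ᵥ v) := by
    intro u v
    rw [Matrix.sub_mulVec, Matrix.one_mulVec, dotProduct_sub]
  have nonneg : ∀ u : n → ℂ, 0 ≤ (star u ⬝ᵥ (D *ᵥ u)).re := fun u => hD.1.re_dotProduct_nonneg u
  have le_one : ∀ u : n → ℂ, IsUnitVec u → (star u ⬝ᵥ (D *ᵥ u)).re ≤ 1 := by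
    intro u hu
    have h1 := hD.2.re_dotProduct_nonneg u
    rw [compl, show star u ⬝ᵥ u = 1 from hu] at h1
    simpa using h1
  have hcs := norm_star_dotProduct_mulVec_le hD.1 x y
  have hcs' := norm_star_dotProduct_mulVec_le hD.2 x y
  rw [compl x x, compl y y, show star x ⬝ᵥ x = 1 from hx, show star y ⬝ᵥ y = 1 from hy,
    Complex.sub_re, Complex.sub_re, Complex.one_re] at hcs'
  have hsum : ‖star x ⬝ᵥ y‖ ≤ ‖star x ⬝ᵥ (D *ᵥ y)‖ + ‖star x ⬝ᵥ ((1 - D) *ᵥ y)‖ := by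
    rw [compl]
    exact (norm_add_le _ _).trans' (by simp)
  have key : tradeoff q ‖star x ⬝ᵥ y‖ ≤ √(star x ⬝ᵥ (D *ᵥ x)).re := by
    refine tradeoff_le_of_le (t := √(star y ⬝ᵥ (D *ᵥ y)).re) hq (norm_nonneg _)
      (hx.norm_star_dotProduct_le_one hy) (Real.sqrt_nonneg _) ?_ (Real.le_sqrt_of_sq_le h) ?_ ?_
    · exact Real.sqrt_le_one.2 (le_one x hx)
    · exact Real.sqrt_le_one.2 (le_one y hy)
    · rw [Real.sq_sqrt (nonneg x), Real.sq_sqrt (nonneg y)]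
      linarith
  calc tradeoff q ‖star x ⬝ᵥ y‖ ^ 2 ≤ √(star x ⬝ᵥ (D *ᵥ x)).re ^ 2 := by
        gcongr
        exact tradeoff_nonneg _ _
    _ = _ := Real.sq_sqrt (nonneg x)

lemma star_dotProduct_proj_mulVec (φ u : n → ℂ) :
    star u ⬝ᵥ (proj φ *ᵥ u) = ((‖star u ⬝ᵥ φ‖ ^ 2 : ℝ) : ℂ) := by
  rw [proj, Matrix.vecMulVec_mulVec, ← conj_star_dotProduct u φ]
  simp only [op_smul_eq_smul, dotProduct_smul, smul_eq_mul, RCLike.star_def]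
  rw [Complex.conj_mul', Complex.ofReal_pow]

lemma isEffect_of_isHermitian_of_mul_self {P : Matrix n n ℂ} (hP : P.IsHermitian)
    (hPP : P * P = P) : IsEffect P := by
  have h : (1 - P)ᴴ * (1 - P) = 1 - P := by
    rw [Matrix.conjTranspose_sub, Matrix.conjTranspose_one, hP.eq, sub_mul, mul_sub, mul_sub, hPP]
    simp
  constructor
  · rw [← hPP]
    nth_rewrite 1 [← hP.eq]
    exact Matrix.posSemidef_conjTranspose_mul_self _
  · rw [← h]
    exact Matrix.posSemidef_conjTranspose_mul_self _

lemma IsUnitVec.isEffect_proj {φ : n → ℂ} (hφ : IsUnitVec φ) : IsEffect (proj φ) := by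
  refine isEffect_of_isHermitian_of_mul_self (Matrix.posSemidef_vecMulVec_self_star φ).1 ?_
  rw [proj, Matrix.vecMulVec_mul_vecMulVec, show star φ ⬝ᵥ φ = 1 from hφ, one_smul]

lemma exists_isUnitVec_orthogonal [Nontrivial n] (y : n → ℂ) :
    ∃ η : n → ℂ, IsUnitVec η ∧ star y ⬝ᵥ η = 0 := by
  obtain ⟨v, hv, hv0⟩ : ∃ v ∈ (ℂ ∙ (WithLp.toLp 2 y : EuclideanSpace ℂ n))ᗮ, v ≠ 0 := by
    rw [← Submodule.ne_bot_iff]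
    intro hbot
    have h1 := Submodule.finrank_add_finrank_orthogonal
      (ℂ ∙ (WithLp.toLp 2 y : EuclideanSpace ℂ n))
    rw [hbot, finrank_bot, finrank_euclideanSpace] at h1
    have h2 : Module.finrank ℂ (ℂ ∙ (WithLp.toLp 2 y : EuclideanSpace ℂ n)) ≤ 1 := by
      simpa using finrank_span_le_card (R := ℂ) {(WithLp.toLp 2 y : EuclideanSpace ℂ n)}
    have h3 : 1 < Fintype.card n := Fintype.one_lt_card
    exact absurd (h3.trans_le (h1.ge.trans h2)) (lt_irrefl _)
  refine ⟨((‖v‖ : ℂ)⁻¹ • v).ofLp, ?_, ?_⟩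
  · rw [isUnitVec_iff_norm_toLp, WithLp.toLp_ofLp, norm_smul, norm_inv, Complex.norm_real,
      norm_norm, inv_mul_cancel₀ (norm_ne_zero_iff.2 hv0)]
  · rw [star_dotProduct_eq_inner, WithLp.toLp_ofLp, inner_smul_right,
      (Submodule.mem_orthogonal_singleton_iff_inner_right).1 hv, mul_zero]

lemma exists_eq_smul_add_smul_orthogonal [Nontrivial n] {x y : n → ℂ} (hx : IsUnitVec x)
    (hy : IsUnitVec y) :
    ∃ η : n → ℂ, IsUnitVec η ∧ star y ⬝ᵥ η = 0 ∧
      x = (star y ⬝ᵥ x) • y + (√(1 - ‖star y ⬝ᵥ x‖ ^ 2) : ℂ) • η := by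
  set w := star y ⬝ᵥ x with hw
  have hyy : star y ⬝ᵥ y = 1 := hy
  have hxx : star x ⬝ᵥ x = 1 := hx
  set z := x - w • y with hz
  have hyz : star y ⬝ᵥ z = 0 := by
    rw [hz, dotProduct_sub, dotProduct_smul, hyy, ← hw]; simp
  have hzz : star z ⬝ᵥ z = ((1 - ‖w‖ ^ 2 : ℝ) : ℂ) := by
    have hzy : star z ⬝ᵥ y = 0 := by rw [← conj_star_dotProduct, hyz, star_zero]
    conv_lhs => arg 2; rw [hz]
    rw [dotProduct_sub, dotProduct_smul, hzy, smul_zero, sub_zero, hz, star_sub, sub_dotProduct,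
      hxx, star_smul, smul_dotProduct, ← hw]
    rw [smul_eq_mul, RCLike.star_def, Complex.conj_mul']
    push_cast; ring
  rw [star_dotProduct_self_eq_norm_sq] at hzz
  have hzz' : ‖WithLp.toLp 2 z‖ ^ 2 = 1 - ‖w‖ ^ 2 := by exact_mod_cast hzz
  rw [← hzz', Real.sqrt_sq (norm_nonneg _)]
  by_cases h0 : ‖WithLp.toLp 2 z‖ = 0
  · obtain ⟨η, hη, hη'⟩ := exists_isUnitVec_orthogonal y
    refine ⟨η, hη, hη', ?_⟩
    have hz0 : z = 0 := by simpa using h0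
    rw [h0, ← sub_eq_zero, ← sub_sub, ← hz, hz0]; simp
  · have h0' : ((‖WithLp.toLp 2 z‖ : ℝ) : ℂ) ≠ 0 := by exact_mod_cast h0
    refine ⟨((‖WithLp.toLp 2 z‖ : ℝ) : ℂ)⁻¹ • z, ?_, ?_, ?_⟩
    · rw [isUnitVec_iff_norm_toLp, WithLp.toLp_smul, norm_smul, norm_inv, Complex.norm_real,
        norm_norm, inv_mul_cancel₀ h0]
    · rw [dotProduct_smul, hyz, smul_zero]
    · rw [smul_smul, mul_inv_cancel₀ h0', one_smul, hz]; abel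

lemma exists_norm_one_mul_eq_norm (w : ℂ) : ∃ u : ℂ, ‖u‖ = 1 ∧ w = u * ‖w‖ := by
  by_cases h : w = 0
  · exact ⟨1, by simp, by simp [h]⟩
  · have h' : (‖w‖ : ℂ) ≠ 0 := by simpa using h
    exact ⟨w / ‖w‖, by simp [h], by field_simp⟩

/-- Any pair of amplitudes `α` at `y` and `αc - βs` at `x`, where `c = cos θ` is the overlap of `x`
and `y`, `s = sin θ`, and `α² + β² = 1`, is realised by a unit vector. -/
lemma exists_isUnitVec_amplitudes [Nontrivial n] {x y : n → ℂ} (hx : IsUnitVec x)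
    (hy : IsUnitVec y) {α β : ℝ} (h : α ^ 2 + β ^ 2 = 1) :
    ∃ φ : n → ℂ, IsUnitVec φ ∧ star y ⬝ᵥ φ = α ∧
      ‖star x ⬝ᵥ φ‖ = |α * ‖star x ⬝ᵥ y‖ - β * √(1 - ‖star x ⬝ᵥ y‖ ^ 2)| := by
  obtain ⟨η, hη, hyη, hdec⟩ := exists_eq_smul_add_smul_orthogonal hx hy
  have hyy : star y ⬝ᵥ y = 1 := hy
  have hηη : star η ⬝ᵥ η = 1 := hη
  have hηy : star η ⬝ᵥ y = 0 := by rw [← conj_star_dotProduct, hyη, star_zero]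
  set s := √(1 - ‖star y ⬝ᵥ x‖ ^ 2) with hs
  obtain ⟨u, hu, hw⟩ := exists_norm_one_mul_eq_norm (star y ⬝ᵥ x)
  have hu' : star u * u = 1 := by
    rw [RCLike.star_def, Complex.conj_mul', hu]; simp
  rw [norm_star_dotProduct_comm x y]
  refine ⟨(α : ℂ) • y - (β * star u : ℂ) • η, ?_, ?_, ?_⟩
  · rw [IsUnitVec]
    simp only [star_sub, star_smul, sub_dotProduct, dotProduct_sub, smul_dotProduct,
      dotProduct_smul, hyy, hηη, hyη, hηy, smul_eq_mul]
    simp only [star_mul', RCLike.star_def, Complex.conj_ofReal, Complex.conj_conj]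
    simp only [RCLike.star_def] at hu'
    have : (α : ℂ) ^ 2 + (β : ℂ) ^ 2 = 1 := by exact_mod_cast h
    linear_combination this + (β : ℂ) ^ 2 * hu'
  · rw [dotProduct_sub, dotProduct_smul, dotProduct_smul, hyy, hyη]; simp
  · have hxφ : star x ⬝ᵥ ((α : ℂ) • y - (β * star u : ℂ) • η) =
        star u * ((α * ‖star y ⬝ᵥ x‖ - β * s : ℝ) : ℂ) := by
      have hxy : star x ⬝ᵥ y = star u * ‖star y ⬝ᵥ x‖ := by
        rw [← conj_star_dotProduct, hw, star_mul', norm_mul, hu]; simp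
      have hxη : star x ⬝ᵥ η = s := by
        rw [hdec, star_add, star_smul, star_smul, add_dotProduct, smul_dotProduct, smul_dotProduct,
          hyη, hηη]
        simp
      rw [dotProduct_sub, dotProduct_smul, dotProduct_smul, hxη, hxy]
      push_cast
      simp only [smul_eq_mul]
      ring
    rw [hxφ, norm_mul, norm_star, hu, one_mul, Complex.norm_real, Real.norm_eq_abs]

/-- `tradeoff` is attained by a projection of rank one: of amplitudes `(q, √(1 - q²))` if
`1 ≤ q² + c²`, and otherwise by the projection onto the part of `y` orthogonal to `x`. -/
lemma exists_isUnitVec_tradeoff [Nontrivial n] {x y : n → ℂ} (hx : IsUnitVec x) (hy : IsUnitVec y)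
    {q : ℝ} (hq : 0 ≤ q) (hq1 : q ≤ 1) :
    ∃ φ : n → ℂ, IsUnitVec φ ∧ q ≤ ‖star y ⬝ᵥ φ‖ ∧
      ‖star x ⬝ᵥ φ‖ = tradeoff q ‖star x ⬝ᵥ y‖ := by
  set c := ‖star x ⬝ᵥ y‖ with hc
  have hc0 : 0 ≤ c := norm_nonneg _
  have hc1 : c ≤ 1 := hx.norm_star_dotProduct_le_one hy
  rcases le_total (1 - q ^ 2) (c ^ 2) with h | h
  · obtain ⟨φ, h1, h2, h3⟩ := exists_isUnitVec_amplitudes hx hy (α := q) (β := √(1 - q ^ 2))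
      (by rw [Real.sq_sqrt (by nlinarith)]; ring)
    refine ⟨φ, h1, ?_, ?_⟩
    · rw [h2, Complex.norm_real, Real.norm_of_nonneg hq]
    · have h4 : √(1 - q ^ 2) * √(1 - c ^ 2) ≤ q * c := by
        have a1 : √(1 - q ^ 2) ≤ c := Real.sqrt_le_iff.2 ⟨hc0, h⟩
        have a2 : √(1 - c ^ 2) ≤ q := Real.sqrt_le_iff.2 ⟨hq, by linarith⟩
        calc _ ≤ c * q := by gcongr
          _ = _ := mul_comm _ _
      rw [h3, tradeoff, abs_of_nonneg (by linarith), max_eq_right (by linarith)]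
  · obtain ⟨φ, h1, h2, h3⟩ := exists_isUnitVec_amplitudes hx hy (α := √(1 - c ^ 2)) (β := c)
      (by rw [Real.sq_sqrt (by nlinarith)]; ring)
    refine ⟨φ, h1, ?_, ?_⟩
    · rw [h2, Complex.norm_real, Real.norm_of_nonneg (Real.sqrt_nonneg _)]
      exact Real.le_sqrt_of_sq_le (by linarith)
    · have h4 : q * c ≤ √(1 - q ^ 2) * √(1 - c ^ 2) := by
        have a1 : c ≤ √(1 - q ^ 2) := Real.le_sqrt_of_sq_le h
        have a2 : q ≤ √(1 - c ^ 2) := Real.le_sqrt_of_sq_le (by linarith)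
        calc q * c ≤ √(1 - c ^ 2) * √(1 - q ^ 2) := by gcongr
          _ = _ := mul_comm _ _
      rw [h3, tradeoff, max_eq_left (by linarith), ← hc, mul_comm, sub_self, abs_zero]

/-! ### Diagonalization of unitary matrices -/

section Isometry

variable {E : Type*} [NormedAddCommGroup E] [InnerProductSpace ℂ E] {T : E →ₗ[ℂ] E}

lemma norm_eq_one_of_mem_eigenspace (hT : ∀ v w, inner ℂ (T v) (T w) = inner ℂ v w) {μ : ℂ} {v : E}
    (hv : v ∈ Module.End.eigenspace T μ) (hv0 : v ≠ 0) : ‖μ‖ = 1 := by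
  have h1 : ‖T v‖ = ‖v‖ := by
    rw [@norm_eq_sqrt_re_inner ℂ, @norm_eq_sqrt_re_inner ℂ, hT]
  rw [Module.End.mem_eigenspace_iff.1 hv, norm_smul] at h1
  exact mul_right_cancel₀ (norm_ne_zero_iff.2 hv0) (h1.trans (one_mul _).symm)

lemma orthogonalFamily_eigenspaces_of_isometry
    (hT : ∀ v w, inner ℂ (T v) (T w) = inner ℂ v w) :
    OrthogonalFamily ℂ (fun μ : Module.End.Eigenvalues T => Module.End.eigenspace T (μ : ℂ))
      fun μ => (Module.End.eigenspace T (μ : ℂ)).subtypeₗᵢ := by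
  refine OrthogonalFamily.of_pairwise fun μ ν hμν v hv w hw => ?_
  by_contra hne
  rw [← ne_eq, ne_eq, inner_eq_zero_symm] at hne
  have hv0 : v ≠ 0 := fun h => hne (by rw [h]; simp)
  have h := hT v w
  have hμ := norm_eq_one_of_mem_eigenspace hT hv hv0
  rw [Module.End.mem_eigenspace_iff.1 hv, Module.End.mem_eigenspace_iff.1 hw,
    inner_smul_left, inner_smul_right, ← mul_assoc] at h
  have h1 : (starRingEnd ℂ) (μ : ℂ) * (ν : ℂ) = 1 :=
    mul_right_cancel₀ hne (h.trans (one_mul _).symm)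
  have h2 : (starRingEnd ℂ) (μ : ℂ) * (μ : ℂ) = 1 := by
    rw [Complex.conj_mul', hμ]; simp
  have h3 : (starRingEnd ℂ) (μ : ℂ) ≠ 0 := left_ne_zero_of_mul_eq_one h2
  exact hμν (Subtype.ext (mul_left_cancel₀ h3 (h2.trans h1.symm)))

/-- The orthogonal complement of the eigenspaces of a linear isometry is invariant, so it would
contain an eigenvector if it were not zero. -/
lemma orthogonal_iSup_eigenspaces_of_isometry [FiniteDimensional ℂ E]
    (hT : ∀ v w, inner ℂ (T v) (T w) = inner ℂ v w) :
    (⨆ μ : Module.End.Eigenvalues T, Module.End.eigenspace T (μ : ℂ))ᗮ = ⊥ := by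
  set W := (⨆ μ : Module.End.Eigenvalues T, Module.End.eigenspace T (μ : ℂ))ᗮ with hW
  have hmem : ∀ w, w ∈ W ↔ ∀ μ : Module.End.Eigenvalues T, ∀ v ∈ Module.End.eigenspace T (μ : ℂ),
      inner ℂ v w = 0 := by
    intro w
    rw [hW, ← Submodule.iInf_orthogonal, Submodule.mem_iInf]
    rfl
  have hinv : ∀ w ∈ W, T w ∈ W := by
    intro w hw
    rw [hmem] at hw ⊢
    intro μ v hv
    by_cases hv0 : v = 0
    · rw [hv0, inner_zero_left]
    have hμ := norm_eq_one_of_mem_eigenspace hT hv hv0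
    have h1 : (starRingEnd ℂ) (μ : ℂ) * inner ℂ v (T w) = 0 := by
      rw [← inner_smul_left, ← Module.End.mem_eigenspace_iff.1 hv, hT]
      exact hw μ v hv
    refine (mul_eq_zero.1 h1).resolve_left ?_
    rw [map_eq_zero, ← norm_eq_zero, hμ]
    exact one_ne_zero
  by_contra hne
  have : Nontrivial W := Submodule.nontrivial_iff_ne_bot.2 hne
  obtain ⟨μ, hμ⟩ := Module.End.exists_eigenvalue (T.restrict hinv)
  obtain ⟨⟨w, hw⟩, hw1, hw0⟩ := hμ.exists_hasEigenvector
  have hTw : T w = μ • w := by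
    simpa using congrArg Subtype.val (Module.End.mem_eigenspace_iff.1 hw1)
  have hw0' : w ≠ 0 := fun h => hw0 (Subtype.ext h)
  have hmu : Module.End.HasEigenvalue T μ :=
    Module.End.hasEigenvalue_of_hasEigenvector ⟨Module.End.mem_eigenspace_iff.2 hTw, hw0'⟩
  have h := (hmem w).1 hw ⟨μ, hmu⟩ w (Module.End.mem_eigenspace_iff.2 hTw)
  exact hw0' (inner_self_eq_zero.1 h)

end Isometry

lemma inner_toEuclideanLin_of_mem_unitaryGroup {V : Matrix n n ℂ}
    (hV : V ∈ Matrix.unitaryGroup n ℂ) (v w : EuclideanSpace ℂ n) :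
    inner ℂ (V.toEuclideanLin v) (V.toEuclideanLin w) = inner ℂ v w := by
  have h := star_dotProduct_mul_mulVec Vᴴ V v.ofLp w.ofLp
  rw [← Matrix.star_eq_conjTranspose, Matrix.mem_unitaryGroup_iff'.1 hV, Matrix.one_mulVec,
    Matrix.star_eq_conjTranspose, Matrix.conjTranspose_conjTranspose, star_dotProduct_eq_inner,
    star_dotProduct_eq_inner] at h
  exact h.symm

/-- Every unitary matrix is unitarily diagonalizable, with eigenvalues on the unit circle. -/
lemma exists_unitary_diagonalization {V : Matrix n n ℂ} (hV : V ∈ Matrix.unitaryGroup n ℂ) :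
    ∃ Q ∈ Matrix.unitaryGroup n ℂ, ∃ l : n → ℂ, (∀ j, ‖l j‖ = 1) ∧
      V = Q * Matrix.diagonal l * Qᴴ := by
  classical
  set T := V.toEuclideanLin with hTdef
  have hT := inner_toEuclideanLin_of_mem_unitaryGroup hV
  have hfam := orthogonalFamily_eigenspaces_of_isometry hT
  have hint := hfam.isInternal_iff.2 (orthogonal_iSup_eigenspaces_of_isometry hT)
  have hcard : Module.finrank ℂ (EuclideanSpace ℂ n) = Fintype.card n := finrank_euclideanSpace
  set b := (hint.subordinateOrthonormalBasis hcard hfam).reindex (Fintype.equivFin n).symm with hb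
  have hsub : ∀ j, ∃ μ : ℂ, T (b j) = μ • b j := by
    intro j
    rw [hb, OrthonormalBasis.reindex_apply]
    exact ⟨_, Module.End.mem_eigenspace_iff.1
      (hint.subordinateOrthonormalBasis_subordinate hcard _ hfam)⟩
  choose l hl using hsub
  set Q : Matrix n n ℂ := Matrix.of fun i j => (b j).ofLp i with hQ
  have hQQ : Qᴴ * Q = 1 := by
    ext i j
    have h := orthonormal_iff_ite.1 b.orthonormal i j
    rw [← WithLp.toLp_ofLp 2 (b i), ← WithLp.toLp_ofLp 2 (b j), ← star_dotProduct_eq_inner] at h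
    rw [Matrix.one_apply, ← h]
    rfl
  have hQmem : Q ∈ Matrix.unitaryGroup n ℂ := Matrix.mem_unitaryGroup_iff'.2 hQQ
  have hQQ' : Q * Qᴴ = 1 := Matrix.mem_unitaryGroup_iff.1 hQmem
  refine ⟨Q, hQmem, l, fun j => ?_, ?_⟩
  · exact norm_eq_one_of_mem_eigenspace hT (Module.End.mem_eigenspace_iff.2 (hl j))
      (b.orthonormal.ne_zero j)
  · have hVQ : V * Q = Q * Matrix.diagonal l := by
      ext i j
      have h := congrArg (fun v : EuclideanSpace ℂ n => v.ofLp i) (hl j)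
      rw [Matrix.mul_diagonal, mul_comm]
      exact h
    rw [← hVQ, Matrix.mul_assoc, hQQ', Matrix.mul_one]

lemma spectrum_eq_range_of_diagonalization {Q : Matrix n n ℂ} (hQ : Q ∈ Matrix.unitaryGroup n ℂ)
    (l : n → ℂ) : spectrum ℂ (Q * Matrix.diagonal l * Qᴴ) = Set.range l := by
  have h := Unitary.spectrum_star_right_conjugate (R := ℂ) (a := Matrix.diagonal l)
    (U := (⟨Q, hQ⟩ : unitary (Matrix n n ℂ)))
  rw [← spectrum_diagonal l, ← h]
  rfl

/-! ### The distance from the origin to the numerical range -/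

lemma isUnitVec_setOf_eq_image :
    {ψ : n → ℂ | IsUnitVec ψ} = WithLp.ofLp '' Metric.sphere (0 : EuclideanSpace ℂ n) 1 := by
  ext ψ
  rw [Set.mem_ofPred_eq, isUnitVec_iff_norm_toLp]
  refine ⟨fun h => ⟨WithLp.toLp 2 ψ, by simpa using h, rfl⟩, ?_⟩
  rintro ⟨v, hv, rfl⟩
  simpa using hv

lemma isCompact_isUnitVec : IsCompact {ψ : n → ℂ | IsUnitVec ψ} := by
  rw [isUnitVec_setOf_eq_image]
  exact (isCompact_sphere _ _).image (PiLp.continuous_ofLp 2 _)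

lemma isPreconnected_isUnitVec [Nonempty n] : IsPreconnected {ψ : n → ℂ | IsUnitVec ψ} := by
  rw [isUnitVec_setOf_eq_image]
  refine (isPreconnected_sphere ?_ _ _).image _ (PiLp.continuous_ofLp 2 _).continuousOn
  have h : Module.finrank ℝ (EuclideanSpace ℂ n) = Fintype.card n * 2 := by
    rw [(WithLp.linearEquiv 2 ℝ (n → ℂ)).finrank_eq, Module.finrank_pi_fintype]
    simp [Complex.finrank_real_complex]
  have hpos : 0 < Fintype.card n := Fintype.card_pos
  have h1 : 1 < Module.finrank ℝ (EuclideanSpace ℂ n) := by omega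
  rw [← Module.finrank_eq_rank]
  exact_mod_cast h1

lemma exists_isUnitVec [Nonempty n] : ∃ ψ : n → ℂ, IsUnitVec ψ :=
  ⟨Pi.single (Classical.arbitrary n) 1, by simp [IsUnitVec]⟩

lemma norm_image_qNumericalRange_one (X : Matrix n n ℂ) :
    (fun z : ℂ => ‖z‖) '' qNumericalRange 1 X =
      (fun ψ : n → ℂ => ‖star ψ ⬝ᵥ (X *ᵥ ψ)‖) '' {ψ | IsUnitVec ψ} := by
  ext r
  constructor
  · rintro ⟨z, ⟨ψ, φ, hψ, hφ, h, rfl⟩, rfl⟩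
    refine ⟨ψ, hψ, ?_⟩
    have : WithLp.toLp 2 ψ = WithLp.toLp 2 φ :=
      (inner_eq_one_iff_of_norm_eq_one hψ.norm_toLp hφ.norm_toLp).1
        (by rw [← star_dotProduct_eq_inner, h])
    rw [WithLp.toLp_injective 2 this]
  · rintro ⟨ψ, hψ, rfl⟩
    exact ⟨_, ⟨ψ, ψ, hψ, hψ, hψ, rfl⟩, rfl⟩

lemma continuous_star_dotProduct_mulVec {α : Type*} [TopologicalSpace α] {f g : α → n → ℂ}
    {X : α → Matrix n n ℂ} (hf : Continuous f) (hX : Continuous X) (hg : Continuous g) :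
    Continuous fun a => star (f a) ⬝ᵥ (X a *ᵥ g a) :=
  hf.star.dotProduct (hX.matrix_mulVec hg)

lemma isLeast_nu_one [Nonempty n] (X : Matrix n n ℂ) :
    IsLeast ((fun ψ : n → ℂ => ‖star ψ ⬝ᵥ (X *ᵥ ψ)‖) '' {ψ | IsUnitVec ψ}) (nu 1 X) := by
  rw [nu, norm_image_qNumericalRange_one]
  refine IsCompact.isLeast_sInf (isCompact_isUnitVec.image ?_)
    (Set.Nonempty.image _ exists_isUnitVec)
  exact (continuous_star_dotProduct_mulVec continuous_id continuous_const continuous_id).norm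

lemma nu_one_le [Nonempty n] (X : Matrix n n ℂ) {ψ : n → ℂ} (hψ : IsUnitVec ψ) :
    nu 1 X ≤ ‖star ψ ⬝ᵥ (X *ᵥ ψ)‖ := (isLeast_nu_one X).2 ⟨ψ, hψ, rfl⟩

lemma nu_one_nonneg [Nonempty n] (X : Matrix n n ℂ) : 0 ≤ nu 1 X := by
  obtain ⟨ψ, -, h⟩ := (isLeast_nu_one X).1
  exact h ▸ norm_nonneg _

lemma mem_diagonalUnitaries_iff {E : Matrix n n ℂ} :
    E ∈ diagonalUnitaries n ↔ ∃ e : n → ℂ, (∀ i, ‖e i‖ = 1) ∧ E = Matrix.diagonal e := by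
  have key : ∀ e : n → ℂ, Matrix.diagonal e ∈ Matrix.unitaryGroup n ℂ ↔ ∀ i, ‖e i‖ = 1 := by
    intro e
    rw [Matrix.mem_unitaryGroup_iff, Matrix.star_eq_conjTranspose, Matrix.diagonal_conjTranspose,
      Matrix.diagonal_mul_diagonal, ← Matrix.diagonal_one, Matrix.diagonal_injective.eq_iff,
      funext_iff]
    refine forall_congr' fun i => ?_
    rw [Pi.star_apply, RCLike.star_def, Complex.mul_conj', ← Complex.ofReal_pow]
    rw [Complex.ofReal_eq_one, pow_eq_one_iff_of_nonneg (norm_nonneg _) two_ne_zero]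
  constructor
  · rintro ⟨h1, h2⟩
    refine ⟨E.diag, (key _).1 ?_, h2.diagonal_diag.symm⟩
    rwa [h2.diagonal_diag]
  · rintro ⟨e, he, rfl⟩
    exact ⟨(key e).2 he, Matrix.isDiag_diagonal e⟩

/-- By compactness there is a diagonal unitary `E` for which `ν(UE)` is largest. -/
lemma exists_isMax_nu_one [Nonempty n] (U : Matrix n n ℂ) :
    ∃ E₀ ∈ diagonalUnitaries n, ∀ E ∈ diagonalUnitaries n, nu 1 (U * E) ≤ nu 1 (U * E₀) := by
  have hK : IsCompact (Set.univ.pi fun _ : n => Metric.sphere (0 : ℂ) 1) :=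
    isCompact_univ_pi fun _ => isCompact_sphere _ _
  have hcont : Continuous fun e : n → ℂ => nu 1 (U * Matrix.diagonal e) := by
    simp only [nu, norm_image_qNumericalRange_one]
    refine IsCompact.continuous_sInf
      (f := fun (e : n → ℂ) (ψ : n → ℂ) => ‖star ψ ⬝ᵥ ((U * Matrix.diagonal e) *ᵥ ψ)‖)
      isCompact_isUnitVec ?_
    refine (continuous_star_dotProduct_mulVec continuous_snd ?_ continuous_snd).norm
    exact continuous_const.matrix_mul continuous_fst.matrix_diagonal
  obtain ⟨e, he, hmax⟩ := hK.exists_isMaxOn ⟨fun _ => 1, by simp⟩ hcont.continuousOn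
  refine ⟨Matrix.diagonal e, mem_diagonalUnitaries_iff.2 ⟨e, by simpa using he, rfl⟩, ?_⟩
  intro E hE
  obtain ⟨f, hf, rfl⟩ := mem_diagonalUnitaries_iff.1 hE
  exact hmax (show f ∈ _ by simpa using hf)

/-- For a unitary matrix `V` and `0 ≤ q ≤ 1`, the distance from the origin to the `q`-numerical
range is a function of the distance to the numerical range. -/
lemma isLeast_tradeoff_nu [Nontrivial n] {V : Matrix n n ℂ} (hV : V ∈ Matrix.unitaryGroup n ℂ)
    {q : ℝ} (hq : 0 ≤ q) (hq1 : q ≤ 1) :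
    IsLeast ((fun z : ℂ => ‖z‖) '' qNumericalRange (q : ℂ) V) (tradeoff q (nu 1 V)) := by
  have hVs : Vᴴ ∈ Matrix.unitaryGroup n ℂ := by
    rw [← Matrix.star_eq_conjTranspose]; exact Unitary.star_mem hV
  constructor
  -- If `ν ^ 2 + q ^ 2 < 1`, the amplitude `qc - √(1-q²)√(1-c²)` at the overlap `c = ν` is
  -- negative, and the value `0` is taken at a vector with overlap `√(1-q²)`, which exists
  -- because the unit sphere is connected.
  · obtain ⟨ψ, hψ, hc⟩ : ∃ ψ : n → ℂ, IsUnitVec ψ ∧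
        ‖star ψ ⬝ᵥ (V *ᵥ ψ)‖ = max (nu 1 V) (√(1 - q ^ 2)) := by
      obtain ⟨ψ₀, hψ₀, h₀⟩ := (isLeast_nu_one V).1
      rcases le_total (√(1 - q ^ 2)) (nu 1 V) with h | h
      · exact ⟨ψ₀, hψ₀, by rw [max_eq_left h]; exact h₀⟩
      · obtain ⟨Q, hQ, l, hl, hVQ⟩ := exists_unitary_diagonalization hV
        obtain ⟨j⟩ := (inferInstance : Nonempty n)
        have hψ₁ : IsUnitVec (Q *ᵥ Pi.single j 1) :=
          IsUnitVec.mulVec hQ (by simp [IsUnitVec])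
        have h₁ : ‖star (Q *ᵥ Pi.single j 1) ⬝ᵥ (V *ᵥ (Q *ᵥ Pi.single j 1))‖ = 1 := by
          have hQQ : Qᴴ * Q = 1 := Matrix.mem_unitaryGroup_iff'.1 hQ
          have : V *ᵥ (Q *ᵥ Pi.single j 1) = l j • (Q *ᵥ Pi.single j 1) := by
            rw [hVQ, Matrix.mulVec_mulVec, Matrix.mul_assoc, hQQ, Matrix.mul_one,
              ← Matrix.mulVec_mulVec, ← Matrix.mulVec_smul]
            congr 1
            ext i
            simp [Pi.single_apply]
          rw [this, dotProduct_smul, show star _ ⬝ᵥ _ = (1 : ℂ) from hψ₁]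
          simpa using hl j
        have hcont : Continuous fun ψ : n → ℂ => ‖star ψ ⬝ᵥ (V *ᵥ ψ)‖ :=
          (continuous_star_dotProduct_mulVec continuous_id continuous_const continuous_id).norm
        obtain ⟨ψ, hψ, hval⟩ := (isPreconnected_isUnitVec (n := n)).intermediate_value hψ₀ hψ₁
          hcont.continuousOn (show √(1 - q ^ 2) ∈ Set.Icc _ _ from
            ⟨by simp only [] at h₀; rw [h₀]; exact h, by
              simp only [h₁]; exact Real.sqrt_le_one.2 (by nlinarith)⟩)
        exact ⟨ψ, hψ, by rw [max_eq_right h]; exact hval⟩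
    have hx : IsUnitVec (Vᴴ *ᵥ ψ) := IsUnitVec.mulVec hVs hψ
    have hov : ‖star (Vᴴ *ᵥ ψ) ⬝ᵥ ψ‖ = max (nu 1 V) (√(1 - q ^ 2)) := by
      rw [← star_dotProduct_mulVec]; exact hc
    have hle : max (nu 1 V) (√(1 - q ^ 2)) ≤ 1 := by
      rw [← hov]; exact hx.norm_star_dotProduct_le_one hψ
    obtain ⟨φ, hφ, h1, h2⟩ := exists_isUnitVec_amplitudes hx hψ (α := q) (β := √(1 - q ^ 2))
      (by rw [Real.sq_sqrt (by nlinarith)]; ring)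
    refine ⟨_, ⟨ψ, φ, hψ, hφ, h1, rfl⟩, ?_⟩
    simp only []
    rw [star_dotProduct_mulVec, h2, hov]
    rcases le_total (√(1 - q ^ 2)) (nu 1 V) with h | h
    · rw [max_eq_left h] at hle ⊢
      have hn := nu_one_nonneg V
      have a2 : √(1 - nu 1 V ^ 2) ≤ q := by
        refine Real.sqrt_le_iff.2 ⟨hq, ?_⟩
        have := (Real.sqrt_le_left hn).1 h
        linarith
      have : √(1 - q ^ 2) * √(1 - nu 1 V ^ 2) ≤ nu 1 V * q := by gcongr
      rw [tradeoff, abs_of_nonneg (by linarith), max_eq_right (by linarith)]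
    · rw [max_eq_right h, Real.sq_sqrt (by nlinarith), sub_sub_cancel, Real.sqrt_sq hq, mul_comm,
        sub_self, abs_zero, tradeoff, max_eq_left]
      have a2 : q ≤ √(1 - nu 1 V ^ 2) := by
        refine Real.le_sqrt_of_sq_le ?_
        have h3 : nu 1 V ^ 2 ≤ √(1 - q ^ 2) ^ 2 := by gcongr; exact nu_one_nonneg V
        rw [Real.sq_sqrt (by nlinarith)] at h3
        linarith
      have : nu 1 V * q ≤ √(1 - q ^ 2) * √(1 - nu 1 V ^ 2) := by gcongr
      linarith
  · rintro r ⟨z, ⟨ψ, φ, hψ, hφ, h, rfl⟩, rfl⟩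
    have hx : IsUnitVec (Vᴴ *ᵥ ψ) := IsUnitVec.mulVec hVs hψ
    simp only []
    refine (tradeoff_mono hq (nu_one_nonneg V) (nu_one_le V hψ)).trans ?_
    rw [star_dotProduct_mulVec, star_dotProduct_mulVec]
    have hD := tradeoff_sq_le_of_isEffect hφ.isEffect_proj hx hψ hq
      (by rw [star_dotProduct_proj_mulVec, Complex.ofReal_re, h, Complex.norm_real,
        Real.norm_of_nonneg hq])
    rw [star_dotProduct_proj_mulVec, Complex.ofReal_re] at hD
    exact (pow_le_pow_iff_left₀ (tradeoff_nonneg _ _) (norm_nonneg _) two_ne_zero).1 hD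

lemma nu_eq_tradeoff [Nontrivial n] {V : Matrix n n ℂ} (hV : V ∈ Matrix.unitaryGroup n ℂ)
    {q : ℝ} (hq : 0 ≤ q) (hq1 : q ≤ 1) : nu (q : ℂ) V = tradeoff q (nu 1 V) :=
  (isLeast_tradeoff_nu hV hq hq1).csInf_eq

/-! ### Density matrices and the numerical range -/

lemma IsDensity.diag_eq_re {ρ : Matrix n n ℂ} (hρ : IsDensity ρ) (i : n) :
    ρ i i = ((ρ i i).re : ℂ) :=
  (Complex.eq_re_of_ofReal_le (r := 0) (by simpa using hρ.1.diag_nonneg))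

lemma IsDensity.diag_re_nonneg {ρ : Matrix n n ℂ} (hρ : IsDensity ρ) (i : n) :
    0 ≤ (ρ i i).re := (Complex.le_def.1 (hρ.1.diag_nonneg (i := i))).1

lemma IsDensity.sum_diag_re {ρ : Matrix n n ℂ} (hρ : IsDensity ρ) : ∑ i, (ρ i i).re = 1 := by
  have h := congrArg Complex.re hρ.2
  simpa [Matrix.trace] using h

lemma IsDensity.conj {ρ : Matrix n n ℂ} (hρ : IsDensity ρ) {Q : Matrix n n ℂ}
    (hQ : Q ∈ Matrix.unitaryGroup n ℂ) : IsDensity (Qᴴ * ρ * Q) := by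
  refine ⟨hρ.1.conjTranspose_mul_mul_same Q, ?_⟩
  rw [Matrix.trace_mul_cycle, ← Matrix.star_eq_conjTranspose, Matrix.mem_unitaryGroup_iff.1 hQ,
    Matrix.one_mul, hρ.2]

lemma IsDensity.smul_add {ρ σ : Matrix n n ℂ} (hρ : IsDensity ρ) (hσ : IsDensity σ) {a b : ℝ}
    (ha : 0 ≤ a) (hb : 0 ≤ b) (hab : a + b = 1) : IsDensity (a • ρ + b • σ) := by
  refine ⟨(hρ.1.smul ha).add (hσ.1.smul hb), ?_⟩
  rw [Matrix.trace_add, Matrix.trace_smul, Matrix.trace_smul, hρ.2, hσ.2, ← add_smul, hab, one_smul]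

lemma convex_isDensity : Convex ℝ {ρ : Matrix n n ℂ | IsDensity ρ} :=
  fun _ hρ _ hσ _ _ ha hb hab => hρ.smul_add hσ ha hb hab

/-- The density matrices are the matrices `AᴴA` with `A` of Frobenius norm one. -/
lemma isCompact_isDensity : IsCompact {ρ : Matrix n n ℂ | IsDensity ρ} := by
  set K : Set (Matrix n n ℂ) := {A | (Aᴴ * A).trace = 1} with hK
  have hcont : Continuous fun A : Matrix n n ℂ => Aᴴ * A :=
    continuous_id.matrix_conjTranspose.matrix_mul continuous_id
  have hclosed : IsClosed K := isClosed_eq hcont.matrix_trace continuous_const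
  have hsub : K ⊆
      Set.univ.pi fun _ : n => Set.univ.pi fun _ : n => Metric.closedBall (0 : ℂ) 1 := by
    intro A hA i _ j _
    have h1 : ∑ k, ∑ l, ‖A l k‖ ^ 2 = 1 := by
      have h2 := congrArg Complex.re (show (Aᴴ * A).trace = 1 from hA)
      simp only [Matrix.trace, Matrix.diag_apply, Matrix.mul_apply, Matrix.conjTranspose_apply,
        RCLike.star_def, Complex.conj_mul'] at h2
      exact_mod_cast h2
    have h3 : ‖A i j‖ ^ 2 ≤ 1 := by
      rw [← h1]
      refine le_trans ?_ (Finset.single_le_sum (f := fun k => ∑ l, ‖A l k‖ ^ 2)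
        (fun k _ => Finset.sum_nonneg fun l _ => by positivity) (Finset.mem_univ j))
      exact Finset.single_le_sum (f := fun l => ‖A l j‖ ^ 2) (fun l _ => by positivity)
        (Finset.mem_univ i)
    rw [mem_closedBall_zero_iff]
    exact (sq_le_one_iff₀ (norm_nonneg _)).1 h3
  have hKc : IsCompact K :=
    IsCompact.of_isClosed_subset
      (isCompact_univ_pi fun _ => isCompact_univ_pi fun _ => isCompact_closedBall _ _) hclosed hsub
  convert hKc.image hcont using 1
  ext ρ
  constructor
  · intro hρ
    obtain ⟨S, hS, h⟩ := exists_posSemidef_mul_self hρ.1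
    refine ⟨S, ?_, ?_⟩
    · rw [hK, Set.mem_ofPred_eq, hS.1.eq, h]; exact hρ.2
    · simp only []; rw [hS.1.eq, h]
  · rintro ⟨A, hA, rfl⟩
    exact ⟨Matrix.posSemidef_conjTranspose_mul_self A, hA⟩

lemma trace_mul_diagonalization (ρ Q : Matrix n n ℂ) (l : n → ℂ) :
    (ρ * (Q * Matrix.diagonal l * Qᴴ)).trace = ∑ j, (Qᴴ * ρ * Q) j j * l j := by
  rw [← Matrix.mul_assoc, Matrix.trace_mul_comm, ← Matrix.mul_assoc, ← Matrix.mul_assoc,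
    Matrix.trace]
  simp only [Matrix.diag_apply, Matrix.mul_diagonal]

/-- The numerical range of a unitary matrix contains the convex hull of its eigenvalues. -/
lemma nu_one_le_of_weights [Nonempty n] {Q : Matrix n n ℂ} (hQ : Q ∈ Matrix.unitaryGroup n ℂ)
    (l : n → ℂ) {p : n → ℝ} (hp : ∀ j, 0 ≤ p j) (hp1 : ∑ j, p j = 1) :
    nu 1 (Q * Matrix.diagonal l * Qᴴ) ≤ ‖∑ j, (p j : ℂ) * l j‖ := by
  set s : n → ℂ := fun j => (√(p j) : ℂ) with hs
  have hss : ∀ j, star (s j) * s j = p j := by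
    intro j
    simp only [hs, RCLike.star_def, Complex.conj_ofReal]
    rw [← Complex.ofReal_mul, Real.mul_self_sqrt (hp j)]
  have hunit : IsUnitVec s := by
    rw [IsUnitVec, dotProduct]
    simp only [Pi.star_apply, hss]
    exact_mod_cast hp1
  refine (nu_one_le _ (IsUnitVec.mulVec hQ hunit)).trans (le_of_eq ?_)
  have hQQ : Qᴴ * Q = 1 := Matrix.mem_unitaryGroup_iff'.1 hQ
  rw [Matrix.mulVec_mulVec, Matrix.mul_assoc, hQQ, Matrix.mul_one, star_dotProduct_mul_mulVec,
    Matrix.mulVec_mulVec, hQQ, Matrix.one_mulVec, dotProduct]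
  congr 1
  refine Finset.sum_congr rfl fun j _ => ?_
  rw [Matrix.mulVec_diagonal, Pi.star_apply, mul_comm (l j), ← mul_assoc, hss]

lemma nu_one_le_norm_trace [Nonempty n] {V : Matrix n n ℂ} (hV : V ∈ Matrix.unitaryGroup n ℂ)
    {ρ : Matrix n n ℂ} (hρ : IsDensity ρ) : nu 1 V ≤ ‖(ρ * V).trace‖ := by
  obtain ⟨Q, hQ, l, -, rfl⟩ := exists_unitary_diagonalization hV
  have h := hρ.conj hQ
  refine (nu_one_le_of_weights hQ l h.diag_re_nonneg h.sum_diag_re).trans (le_of_eq ?_)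
  rw [trace_mul_diagonalization]
  congr 1
  exact Finset.sum_congr rfl fun j _ => by rw [← h.diag_eq_re]

lemma IsUnitVec.isDensity_proj {ψ : n → ℂ} (hψ : IsUnitVec ψ) : IsDensity (proj ψ) :=
  ⟨hψ.isEffect_proj.1, by rw [proj, Matrix.trace_vecMulVec, dotProduct_comm]; exact hψ⟩

lemma trace_proj_mul (ψ : n → ℂ) (X : Matrix n n ℂ) :
    (proj ψ * X).trace = star ψ ⬝ᵥ (X *ᵥ ψ) := by
  rw [Matrix.trace_mul_comm, proj, Matrix.mul_vecMulVec, Matrix.trace_vecMulVec, dotProduct_comm]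

lemma exists_weights_nu_one_eq [Nonempty n] {Q : Matrix n n ℂ} (hQ : Q ∈ Matrix.unitaryGroup n ℂ)
    (l : n → ℂ) : ∃ p : n → ℝ, (∀ j, 0 ≤ p j) ∧ ∑ j, p j = 1 ∧
      nu 1 (Q * Matrix.diagonal l * Qᴴ) = ‖∑ j, (p j : ℂ) * l j‖ := by
  obtain ⟨ψ, hψ, h⟩ := (isLeast_nu_one (Q * Matrix.diagonal l * Qᴴ)).1
  have hρ := (IsUnitVec.isDensity_proj hψ).conj hQ
  refine ⟨_, hρ.diag_re_nonneg, hρ.sum_diag_re, ?_⟩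
  rw [← h]
  simp only []
  rw [← trace_proj_mul, trace_mul_diagonalization]
  congr 1
  exact Finset.sum_congr rfl fun j _ => by rw [← hρ.diag_eq_re]

/-! ### The minimax argument -/

lemma isDensity_eigenprojection {Q : Matrix n n ℂ} (hQ : Q ∈ Matrix.unitaryGroup n ℂ) (j : n) :
    IsDensity (Q * Matrix.single j j (1 : ℂ) * Qᴴ) := by
  have h : (Matrix.single j j (1 : ℂ)).PosSemidef := by
    rw [← Matrix.diagonal_single]
    exact Matrix.PosSemidef.diagonal (Pi.single_nonneg.2 zero_le_one)
  refine ⟨h.mul_mul_conjTranspose_same Q, ?_⟩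
  rw [Matrix.trace_mul_cycle, ← Matrix.star_eq_conjTranspose, Matrix.mem_unitaryGroup_iff'.1 hQ,
    Matrix.one_mul, Matrix.trace_single_eq_same]

lemma eigenprojection_mul {Q : Matrix n n ℂ} (hQ : Q ∈ Matrix.unitaryGroup n ℂ) (l : n → ℂ)
    (j : n) : Q * Matrix.single j j (1 : ℂ) * Qᴴ * (Q * Matrix.diagonal l * Qᴴ) =
      l j • (Q * Matrix.single j j (1 : ℂ) * Qᴴ) := by
  have hQQ : Qᴴ * Q = 1 := Matrix.mem_unitaryGroup_iff'.1 hQ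
  have h : Matrix.single j j (1 : ℂ) * Matrix.diagonal l = l j • Matrix.single j j (1 : ℂ) := by
    ext a b
    rw [Matrix.mul_diagonal, Matrix.smul_apply, Matrix.single_apply, smul_eq_mul]
    split_ifs with hab
    · rw [hab.2, mul_comm]
    · simp
  calc _ = Q * (Matrix.single j j (1 : ℂ) * ((Qᴴ * Q) * Matrix.diagonal l)) * Qᴴ := by
        simp only [Matrix.mul_assoc]
    _ = _ := by rw [hQQ, Matrix.one_mul, h, Matrix.mul_smul, Matrix.smul_mul]

/-- If `ν(UE) ≤ r` for all diagonal unitaries `E`, some density matrix `ρ` satisfies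
`∑ i, |⟨i|ρU|i⟩| ≤ r`. Otherwise a linear functional `∑ i, e i * z i` separates the vectors
`⟨i|ρU|i⟩` from the `ℓ¹`-ball of radius `r`; with `E` the phases of `e`, the separation on the
eigenprojections of `UE` shows that all eigenvalues of `UE` have real part greater than `r`. -/
lemma exists_isDensity_sum_norm_le [Nonempty n] {U : Matrix n n ℂ}
    (hU : U ∈ Matrix.unitaryGroup n ℂ) {r : ℝ} (hr : 0 ≤ r)
    (h : ∀ E ∈ diagonalUnitaries n, nu 1 (U * E) ≤ r) :
    ∃ ρ : Matrix n n ℂ, IsDensity ρ ∧ ∑ i, ‖(ρ * U) i i‖ ≤ r := by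
  by_contra! hcon
  set L : Matrix n n ℂ →ₗ[ℝ] (n → ℂ) :=
    { toFun := fun ρ i => (ρ * U) i i
      map_add' := fun ρ σ => by ext i; simp [Matrix.add_mul]
      map_smul' := fun c ρ => by ext i; simp } with hL
  have hLc : Continuous L := by
    refine continuous_pi fun i => ?_
    exact (continuous_id.matrix_mul continuous_const).matrix_elem i i
  set B : Set (n → ℂ) := {z | ∑ i, ‖z i‖ ≤ r} with hB
  have hBconv : Convex ℝ B := by
    intro z hz w hw a b ha hb hab
    rw [hB, Set.mem_ofPred_eq] at hz hw ⊢
    calc ∑ i, ‖(a • z + b • w) i‖ ≤ ∑ i, (a * ‖z i‖ + b * ‖w i‖) := by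
          refine Finset.sum_le_sum fun i _ => ?_
          refine (norm_add_le _ _).trans (le_of_eq ?_)
          simp [abs_of_nonneg ha, abs_of_nonneg hb]
      _ = a * ∑ i, ‖z i‖ + b * ∑ i, ‖w i‖ := by
          rw [Finset.sum_add_distrib, Finset.mul_sum, Finset.mul_sum]
      _ ≤ a * r + b * r := by gcongr
      _ = r := by rw [← add_mul, hab, one_mul]
  have hBclosed : IsClosed B :=
    isClosed_le (continuous_finsetSum _ fun i _ => (continuous_apply i).norm) continuous_const
  have hdisj : Disjoint B (L '' {ρ | IsDensity ρ}) := by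
    rw [Set.disjoint_right]
    rintro _ ⟨ρ, hρ, rfl⟩ hmem
    exact absurd (hcon ρ hρ) (not_lt.2 hmem)
  obtain ⟨f, u, v, hfB, huv, hfC⟩ := RCLike.geometric_hahn_banach_closed_compact (𝕜 := ℂ)
    hBconv hBclosed (convex_isDensity.linear_image L) (isCompact_isDensity.image hLc) hdisj
  have hf : ∀ z : n → ℂ, f z = ∑ i, f (Pi.single i 1) * z i := by
    intro z
    conv_lhs => rw [← Finset.univ_sum_single z]
    rw [map_sum]
    refine Finset.sum_congr rfl fun i _ => ?_
    rw [mul_comm, ← smul_eq_mul, ← map_smul, ← Pi.single_smul', smul_eq_mul, mul_one]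
  choose ω hω hωe using fun i => exists_norm_one_mul_eq_norm (f (Pi.single i 1))
  set t : n → ℝ := fun i => ‖f (Pi.single i 1)‖ with ht
  have hωω : ∀ i, ω i * star (ω i) = 1 := by
    intro i; rw [RCLike.star_def, Complex.mul_conj', hω]; simp
  have htu : ∀ i, r * t i ≤ u := by
    intro i
    have hmem : Pi.single i (r * star (ω i)) ∈ B := by
      rw [hB, Set.mem_ofPred_eq, Finset.sum_eq_single i]
      · rw [Pi.single_eq_same, norm_mul, norm_star, hω, mul_one, Complex.norm_real,
          Real.norm_of_nonneg hr]
      · intro j _ hj; rw [Pi.single_eq_of_ne hj, norm_zero]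
      · simp
    have h1 := hfB _ hmem
    rw [hf, Finset.sum_eq_single i (by intro j _ hj; rw [Pi.single_eq_of_ne hj, mul_zero])
      (by simp), Pi.single_eq_same, hωe,
      show ω i * (‖f (Pi.single i 1)‖ : ℂ) * (r * star (ω i)) =
        (ω i * star (ω i)) * ((r * t i : ℝ) : ℂ) by push_cast; ring, hωω, one_mul] at h1
    exact le_of_lt (by simpa using h1)
  have hE : Matrix.diagonal ω ∈ diagonalUnitaries n := mem_diagonalUnitaries_iff.2 ⟨ω, hω, rfl⟩
  obtain ⟨Q, hQ, l, -, hVQ⟩ := exists_unitary_diagonalization (mul_mem hU hE.1)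
  have hl : ∀ j, r < (l j).re := by
    intro j
    by_contra! hle
    have hρ := isDensity_eigenprojection hQ j
    set ρ := Q * Matrix.single j j (1 : ℂ) * Qᴴ with hρdef
    have hρV : ρ * (U * Matrix.diagonal ω) = l j • ρ := by
      rw [hVQ]; exact eigenprojection_mul hQ l j
    have h1 := hfC _ ⟨ρ, hρ, rfl⟩
    have h2 : f (L ρ) = ((∑ i, (ρ i i).re * t i : ℝ) : ℂ) * l j := by
      rw [hf, Complex.ofReal_sum, Finset.sum_mul]
      refine Finset.sum_congr rfl fun i _ => ?_
      have h3 : (ρ * U) i i * ω i = l j * ρ i i := by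
        have := congrFun (congrFun hρV i) i
        rwa [← Matrix.mul_assoc, Matrix.mul_diagonal, Matrix.smul_apply, smul_eq_mul] at this
      rw [hωe, hL]
      simp only [LinearMap.coe_mk, AddHom.coe_mk]
      rw [show ω i * (‖f (Pi.single i 1)‖ : ℂ) * (ρ * U) i i =
        ((ρ * U) i i * ω i) * (‖f (Pi.single i 1)‖ : ℂ) by ring, h3, hρ.diag_eq_re]
      push_cast
      simp only [ht, Complex.ofReal_re]
      ring
    rw [h2] at h1
    have h4 : v < (∑ i, (ρ i i).re * t i) * (l j).re := by simpa using h1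
    have h5 : 0 ≤ ∑ i, (ρ i i).re * t i :=
      Finset.sum_nonneg fun i _ => mul_nonneg (hρ.diag_re_nonneg i) (norm_nonneg _)
    have h6 : (∑ i, (ρ i i).re * t i) * r ≤ u := by
      calc (∑ i, (ρ i i).re * t i) * r = ∑ i, (ρ i i).re * (r * t i) := by
            rw [Finset.sum_mul]; exact Finset.sum_congr rfl fun i _ => by ring
        _ ≤ ∑ i, (ρ i i).re * u :=
            Finset.sum_le_sum fun i _ => mul_le_mul_of_nonneg_left (htu i) (hρ.diag_re_nonneg i)
        _ = u := by rw [← Finset.sum_mul, hρ.sum_diag_re, one_mul]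
    linarith [mul_le_mul_of_nonneg_left hle h5]
  obtain ⟨p, hp, hp1, hpν⟩ := exists_weights_nu_one_eq hQ l
  have h1 := h _ hE
  rw [hVQ, hpν] at h1
  have h2 := (Complex.re_le_norm _).trans h1
  have h3 : (∑ j, (p j : ℂ) * l j).re = ∑ j, p j * (l j).re := by simp
  rw [h3] at h2
  have h4 : r = ∑ j, p j * r := by rw [← Finset.sum_mul, hp1, one_mul]
  have h5 : ∑ j, p j * r < ∑ j, p j * (l j).re := by
    obtain ⟨j, -, hj⟩ : ∃ j ∈ Finset.univ, 0 < p j := by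
      by_contra! hall
      have := Finset.sum_nonpos hall
      linarith
    exact Finset.sum_lt_sum (fun j _ => mul_le_mul_of_nonneg_left (hl j).le (hp j))
      ⟨j, Finset.mem_univ j, mul_lt_mul_of_pos_left (hl j) hj⟩
  linarith

/-! ### Extremal eigenvalues and discriminators -/

/-- First-order condition at the point `c` of a segment that is nearest to the origin. -/
lemma le_re_of_norm_le_segment {c : ℝ} (hc : 0 < c) {z : ℂ}
    (h : ∀ t : ℝ, 0 ≤ t → t ≤ 1 → c ≤ ‖((1 - t : ℝ) : ℂ) * c + t * z‖) : c ≤ z.re := by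
  by_contra! hlt
  set N := (z.re - c) ^ 2 + z.im ^ 2 with hN
  have hN0 : 0 < N := by have : 0 < c - z.re := by linarith
                         nlinarith [sq_nonneg z.im]
  -- any `t` below `2c(c - Re z) / |z - c|²` gives a point closer to the origin
  set t := min 1 (c * (c - z.re) / N) with ht
  have hd : 0 < c * (c - z.re) := mul_pos hc (by linarith)
  have ht0 : 0 < t := lt_min one_pos (by positivity)
  have htN : t * N ≤ c * (c - z.re) := by
    rw [← le_div_iff₀ hN0]; exact min_le_right _ _
  have h1 := h t ht0.le (min_le_left _ _)
  have h2 : c ^ 2 ≤ ‖((1 - t : ℝ) : ℂ) * c + t * z‖ ^ 2 := by gcongr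
  have h3 : ‖((1 - t : ℝ) : ℂ) * c + t * z‖ ^ 2 = c ^ 2 - 2 * t * (c * (c - z.re)) + t ^ 2 * N := by
    rw [Complex.sq_norm, Complex.normSq_apply]
    simp
    ring
  rw [h3] at h2
  have h4 : t ^ 2 * N ≤ t * (c * (c - z.re)) := by
    rw [sq, mul_assoc]; exact mul_le_mul_of_nonneg_left htN ht0.le
  nlinarith [mul_pos ht0 hd]

/-- If the numerical range of a unitary matrix `V` has distance `c > 0` from the origin, then up to
a phase `u` the spectrum lies on the arc of the unit circle where `c ≤ Re z`, and contains both
endpoints of the arc. -/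
lemma exists_phase_spectrum [Nonempty n] {V : Matrix n n ℂ} (hV : V ∈ Matrix.unitaryGroup n ℂ)
    (hc : 0 < nu 1 V) :
    ∃ u : ℂ, ‖u‖ = 1 ∧ (∀ x ∈ spectrum ℂ V, ‖x‖ = 1 ∧ nu 1 V ≤ (u * x).re) ∧
      (∃ x ∈ spectrum ℂ V, (u * x).im = √(1 - nu 1 V ^ 2)) ∧
      (∃ y ∈ spectrum ℂ V, (u * y).im = -√(1 - nu 1 V ^ 2)) ∧
      (u • V + (u • V)ᴴ - (2 * nu 1 V : ℂ) • 1).PosSemidef := by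
  obtain ⟨Q, hQ, l, hl, hVQ⟩ := exists_unitary_diagonalization hV
  obtain ⟨p, hp, hp1, hpc⟩ := exists_weights_nu_one_eq hQ l
  have hle : ∀ p' : n → ℝ, (∀ j, 0 ≤ p' j) → ∑ j, p' j = 1 → nu 1 V ≤ ‖∑ j, (p' j : ℂ) * l j‖ := by
    intro p' h0 h1
    rw [hVQ]
    exact nu_one_le_of_weights hQ l h0 h1
  rw [← hVQ] at hpc
  set c := nu 1 V with hcdef
  obtain ⟨w, hw, hwc⟩ := exists_norm_one_mul_eq_norm (∑ j, (p j : ℂ) * l j)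
  rw [← hpc] at hwc
  have hww : star w * w = 1 := by rw [RCLike.star_def, Complex.conj_mul', hw]; simp
  have hsum : ∑ j, (p j : ℂ) * (star w * l j) = c := by
    have : ∑ j, (p j : ℂ) * (star w * l j) = star w * ∑ j, (p j : ℂ) * l j := by
      rw [Finset.mul_sum]; exact Finset.sum_congr rfl fun j _ => by ring
    rw [this, hwc, ← mul_assoc, hww, one_mul]
  have hu : ‖star w‖ = 1 := by rw [norm_star, hw]
  have hre : ∀ j, c ≤ (star w * l j).re := by
    intro j
    refine le_re_of_norm_le_segment hc fun t ht0 ht1 => ?_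
    refine (hle (fun k => (1 - t) * p k + t * (Pi.single j 1 : n → ℝ) k) ?_ ?_).trans (le_of_eq ?_)
    · intro k
      have : 0 ≤ (Pi.single j 1 : n → ℝ) k := by
        rw [Pi.single_apply]; split_ifs <;> norm_num
      have := hp k
      have : 0 ≤ 1 - t := by linarith
      positivity
    · rw [Finset.sum_add_distrib, ← Finset.mul_sum, ← Finset.mul_sum, hp1,
        Finset.sum_pi_single' j (1 : ℝ)]
      simp
    · rw [show ∀ z : ℂ, ‖z‖ = ‖star w * z‖ from fun z => by rw [norm_mul, hu, one_mul],
        Finset.mul_sum]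
      congr 1
      rw [← hsum, Finset.mul_sum]
      have h1 : (t : ℂ) * (star w * l j) =
          ∑ k, (t : ℂ) * (((Pi.single j 1 : n → ℝ) k : ℂ) * (star w * l k)) := by
        rw [Finset.sum_eq_single j]
        · simp
        · intro k _ hk; simp [Pi.single_eq_of_ne hk]
        · simp
      rw [h1, ← Finset.sum_add_distrib]
      refine Finset.sum_congr rfl fun k _ => ?_
      push_cast
      ring
  have hnormsq : ∀ j, (star w * l j).re ^ 2 + (star w * l j).im ^ 2 = 1 := by
    intro j
    have h1 : ‖star w * l j‖ ^ 2 = 1 := by rw [norm_mul, hu, hl j]; norm_num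
    rw [Complex.sq_norm, Complex.normSq_apply] at h1
    linarith
  have hsumre : ∑ j, p j * ((star w * l j).re - c) = 0 := by
    have h1 := congrArg Complex.re hsum
    simp only [Complex.re_sum, Complex.re_ofReal_mul, Complex.ofReal_re] at h1
    simp only [mul_sub]
    rw [Finset.sum_sub_distrib, h1, ← Finset.sum_mul, hp1, one_mul, sub_self]
  have hsumim : ∑ j, p j * (star w * l j).im = 0 := by
    have h1 := congrArg Complex.im hsum
    simpa only [Complex.im_sum, Complex.im_ofReal_mul, Complex.ofReal_im] using h1
  have hpim : ∀ j, p j = 0 ∨ (star w * l j).im = √(1 - c ^ 2) ∨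
      (star w * l j).im = -√(1 - c ^ 2) := by
    intro j
    have h1 := (Finset.sum_eq_zero_iff_of_nonneg
      (fun j _ => mul_nonneg (hp j) (sub_nonneg.2 (hre j)))).1 hsumre j (Finset.mem_univ j)
    refine (mul_eq_zero.1 h1).imp id fun h2 => ?_
    have h3 := hnormsq j
    rw [sub_eq_zero.1 h2] at h3
    rw [← sq_eq_sq_iff_eq_or_eq_neg, Real.sq_sqrt (by nlinarith [sq_nonneg (star w * l j).im])]
    linarith
  have hmem : ∀ j, l j ∈ spectrum ℂ V := by
    intro j; rw [hVQ, spectrum_eq_range_of_diagonalization hQ]; exact ⟨j, rfl⟩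
  -- both signs occur, for otherwise the imaginary parts could not average to `0`
  have hboth : ∀ e : ℝ, (e = 1 ∨ e = -1) → ∃ j, (star w * l j).im = e * √(1 - c ^ 2) := by
    intro e he
    by_contra! hno
    have h1 : ∀ j, p j * (star w * l j).im = p j * (-e * √(1 - c ^ 2)) := by
      intro j
      rcases hpim j with h | h | h
      · rw [h]; simp
      · rcases he with rfl | rfl
        · exact absurd (by rw [h, one_mul]) (hno j)
        · rw [h]; ring
      · rcases he with rfl | rfl
        · rw [h]; ring
        · exact absurd (by rw [h]; ring) (hno j)
    simp only [h1] at hsumim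
    rw [← Finset.sum_mul, hp1, one_mul] at hsumim
    have h0 : √(1 - c ^ 2) = 0 := by
      rcases he with rfl | rfl <;> linarith
    obtain ⟨j, hj⟩ : ∃ j, p j ≠ 0 := by
      by_contra! hall
      simp [hall] at hp1
    refine hno j ?_
    rcases (hpim j).resolve_left hj with h | h <;> rw [h, h0] <;> simp
  refine ⟨star w, hu, ?_, ?_, ?_, ?_⟩
  · intro x hx
    rw [hVQ, spectrum_eq_range_of_diagonalization hQ] at hx
    obtain ⟨j, rfl⟩ := hx
    exact ⟨hl j, hre j⟩
  · obtain ⟨j, hj⟩ := hboth 1 (Or.inl rfl)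
    exact ⟨l j, hmem j, by rw [hj, one_mul]⟩
  · obtain ⟨j, hj⟩ := hboth (-1) (Or.inr rfl)
    exact ⟨l j, hmem j, by rw [hj]; ring⟩
  · have hQQ : Q * Qᴴ = 1 := Matrix.mem_unitaryGroup_iff.1 hQ
    have h1 : star w • V + (star w • V)ᴴ - (2 * c : ℂ) • 1 =
        Q * Matrix.diagonal (fun j => ((2 * ((star w * l j).re - c) : ℝ) : ℂ)) * Qᴴ := by
      have h2 : Matrix.diagonal (fun j => ((2 * ((star w * l j).re - c) : ℝ) : ℂ)) =
          star w • Matrix.diagonal l + w • (Matrix.diagonal l)ᴴ - (2 * c : ℂ) • 1 := by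
        rw [Matrix.diagonal_conjTranspose, ← Matrix.diagonal_smul, ← Matrix.diagonal_smul,
          Matrix.diagonal_add, ← Matrix.diagonal_one, ← Matrix.diagonal_smul, Matrix.diagonal_sub]
        congr 1
        ext j
        have h3 := Complex.add_conj (star w * l j)
        simp only [map_mul, RCLike.star_def, Complex.conj_conj] at h3
        simp only [Pi.smul_apply, Pi.star_apply, smul_eq_mul, RCLike.star_def, mul_one, h3]
        push_cast
        ring
      rw [h2, Matrix.mul_sub, Matrix.sub_mul, Matrix.mul_add, Matrix.add_mul, hVQ]
      simp only [Matrix.conjTranspose_smul, Matrix.conjTranspose_mul,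
        Matrix.conjTranspose_conjTranspose, Matrix.mul_smul, Matrix.smul_mul, Matrix.mul_one, hQQ,
        star_star, Matrix.mul_assoc]
    rw [h1]
    refine (Matrix.PosSemidef.diagonal ?_).mul_mul_conjTranspose_same Q
    intro j
    have := hre j
    exact Complex.zero_le_real.2 (show (0 : ℝ) ≤ 2 * ((star w * l j).re - c) by linarith)

/-- On the arc of the unit circle where `0 < c ≤ Re z`, only the endpoints are at least as far
apart as the endpoints. -/
lemma eq_endpoints_of_le_dist {c : ℝ} (hc : 0 < c) {x y : ℂ} (hx : ‖x‖ = 1) (hy : ‖y‖ = 1)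
    (hxc : c ≤ x.re) (hyc : c ≤ y.re) (h : 4 * (1 - c ^ 2) ≤ ‖x - y‖ ^ 2) :
    ∃ σ : ℝ, σ ^ 2 = 1 - c ^ 2 ∧ x = c + σ * Complex.I ∧ y = c - σ * Complex.I := by
  have hx2 : x.re ^ 2 + x.im ^ 2 = 1 := by
    have := Complex.sq_norm x; rw [Complex.normSq_apply, hx] at this; linarith
  have hy2 : y.re ^ 2 + y.im ^ 2 = 1 := by
    have := Complex.sq_norm y; rw [Complex.normSq_apply, hy] at this; linarith
  rw [Complex.sq_norm, Complex.normSq_apply, Complex.sub_re, Complex.sub_im] at h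
  have h1 : (x.re + y.re) ^ 2 ≤ (2 * c) ^ 2 := by nlinarith [sq_nonneg (x.im + y.im)]
  have h2 : x.re + y.re ≤ 2 * c :=
    (pow_le_pow_iff_left₀ (by linarith) (by linarith) two_ne_zero).1 h1
  have hxr : x.re = c := by linarith
  have hyr : y.re = c := by linarith
  have h3 : (x.im + y.im) ^ 2 ≤ 0 := by rw [hxr, hyr] at *; nlinarith
  have h4 : y.im = -x.im := by
    linarith [(pow_eq_zero_iff two_ne_zero).1 (le_antisymm h3 (sq_nonneg _))]
  refine ⟨x.im, by rw [← hxr]; linarith, ?_, ?_⟩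
  · rw [← hxr, Complex.re_add_im]
  · rw [← Complex.re_add_im y, h4, hyr]; push_cast; ring

/-- A pair of most distant eigenvalues is, up to the phase `u`, a pair `c ± iσ`. -/
lemma exists_phase_of_isMostDistantPair [Nonempty n] {V : Matrix n n ℂ}
    (hV : V ∈ Matrix.unitaryGroup n ℂ) (hc : 0 < nu 1 V) {a b : ℂ} (hab : IsMostDistantPair V a b) :
    ∃ (u : ℂ) (σ : ℝ), ‖u‖ = 1 ∧ σ ^ 2 = 1 - nu 1 V ^ 2 ∧ u * a = nu 1 V + σ * Complex.I ∧
      u * b = nu 1 V - σ * Complex.I ∧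
      (u • V + (u • V)ᴴ - (2 * nu 1 V : ℂ) • 1).PosSemidef := by
  obtain ⟨u, hu, hspec, ⟨x, hx, hxi⟩, ⟨y, hy, hyi⟩, hpos⟩ := exists_phase_spectrum hV hc
  obtain ⟨ha, hb, hmax⟩ := hab
  have hc1 : nu 1 V ^ 2 ≤ 1 := by
    obtain ⟨hx1, hx2⟩ := hspec x hx
    have h1 := (Complex.re_le_norm (u * x)).trans' hx2
    rw [norm_mul, hu, hx1, one_mul] at h1
    nlinarith
  have h1 : 4 * (1 - nu 1 V ^ 2) ≤ ‖u * a - u * b‖ ^ 2 := by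
    rw [← mul_sub, norm_mul, hu, one_mul]
    have h2 : ‖x - y‖ ^ 2 ≤ ‖a - b‖ ^ 2 := by gcongr; exact hmax x hx y hy
    have h3 : (u * x - u * y).im ^ 2 ≤ ‖x - y‖ ^ 2 := by
      rw [← mul_sub, ← sq_abs]
      gcongr
      refine (Complex.abs_im_le_norm _).trans ?_
      rw [norm_mul, hu, one_mul]
    rw [Complex.sub_im, hxi, hyi] at h3
    have h4 := Real.sq_sqrt (sub_nonneg.2 hc1)
    nlinarith
  obtain ⟨σ, hσ, h2, h3⟩ := eq_endpoints_of_le_dist hc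
    (by rw [norm_mul, hu, (hspec a ha).1, one_mul]) (by rw [norm_mul, hu, (hspec b hb).1, one_mul])
    (hspec a ha).2 (hspec b hb).2 h1
  exact ⟨u, σ, hu, hσ, h2, h3, hpos⟩

lemma norm_add_of_isMostDistantPair [Nonempty n] {V : Matrix n n ℂ}
    (hV : V ∈ Matrix.unitaryGroup n ℂ) (hc : 0 < nu 1 V) {a b : ℂ} (hab : IsMostDistantPair V a b) :
    ‖a‖ = 1 ∧ ‖b‖ = 1 ∧ ‖a + b‖ = 2 * nu 1 V := by
  obtain ⟨u, σ, hu, -, h2, h3, -⟩ := exists_phase_of_isMostDistantPair hV hc hab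
  obtain ⟨_, -, hspec, -⟩ := exists_phase_spectrum hV hc
  refine ⟨(hspec a hab.1).1, (hspec b hab.2.1).1, ?_⟩
  rw [← one_mul ‖a + b‖, ← hu, ← norm_mul, mul_add, h2, h3,
    show (nu 1 V + σ * Complex.I : ℂ) + (nu 1 V - σ * Complex.I) = ((2 * nu 1 V : ℝ) : ℂ) by
      push_cast; ring, Complex.norm_real, Real.norm_of_nonneg (by linarith)]

lemma trace_mul_nonneg_of_posSemidef {A M : Matrix n n ℂ} (hA : A.PosSemidef) (hM : M.PosSemidef) :
    0 ≤ (A * M).trace := by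
  obtain ⟨S, hS, rfl⟩ := exists_posSemidef_mul_self hA
  rw [Matrix.mul_assoc, Matrix.trace_mul_comm]
  have h := (hM.mul_mul_conjTranspose_same S).trace_nonneg
  rwa [hS.1.eq] at h

lemma mul_eq_zero_of_trace_eq_zero {A M : Matrix n n ℂ} (hA : A.PosSemidef) (hM : M.PosSemidef)
    (h : (A * M).trace = 0) : M * A = 0 := by
  obtain ⟨S, hS, rfl⟩ := exists_posSemidef_mul_self hA
  obtain ⟨T, hT, rfl⟩ := exists_posSemidef_mul_self hM
  have h1 : ((T * S)ᴴ * (T * S)).trace = 0 := by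
    rw [Matrix.conjTranspose_mul, hS.1.eq, hT.1.eq, Matrix.trace_mul_comm, ← h,
      Matrix.trace_mul_comm]
    rw [Matrix.trace_mul_comm, Matrix.mul_assoc, Matrix.trace_mul_comm]
    simp only [Matrix.mul_assoc]
  have h2 := Matrix.trace_conjTranspose_mul_self_eq_zero_iff.1 h1
  calc T * T * (S * S) = T * (T * S) * S := by simp only [Matrix.mul_assoc]
    _ = 0 := by rw [h2]; simp

/-- A state `ρ` on which the unitary `W` satisfies `W² - 2cW + 1 = 0`, and for which the diagonal of
`ρW` is real, splits into two states with the same diagonal, supported on the eigenspaces for the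
roots `c ± iσ`. -/
lemma exists_split_of_real_diag {W ρ : Matrix n n ℂ} (hW : W ∈ Matrix.unitaryGroup n ℂ)
    (hρ : IsDensity ρ) {c σ : ℝ} (hσ : σ ^ 2 = 1 - c ^ 2)
    (hker : W * ρ + Wᴴ * ρ = (2 * c : ℂ) • ρ) (hdiag : ∀ i, ((ρ * W) i i).im = 0) :
    ∃ ρ₁ ρ₂ : Matrix n n ℂ, IsDensity ρ₁ ∧ IsDensity ρ₂ ∧
      W * ρ₁ = (c + σ * Complex.I : ℂ) • ρ₁ ∧ W * ρ₂ = (c - σ * Complex.I : ℂ) • ρ₂ ∧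
      ρ₁.diag = ρ₂.diag := by
  have hWW : W * Wᴴ = 1 := Matrix.mem_unitaryGroup_iff.1 hW
  have hWW' : Wᴴ * W = 1 := Matrix.mem_unitaryGroup_iff'.1 hW
  have hW' : Wᴴ * ρ = (2 * c : ℂ) • ρ - W * ρ := by rw [← hker]; abel
  have hσ' : (σ : ℂ) ^ 2 = 1 - (c : ℂ) ^ 2 := by exact_mod_cast hσ
  have hI : Complex.I ^ 2 = -1 := Complex.I_sq
  have hWWρ : W * (W * ρ) = (2 * c : ℂ) • (W * ρ) - ρ := by
    have h := congrArg (W * ·) hW'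
    simp only [Matrix.mul_sub, Matrix.mul_smul, ← Matrix.mul_assoc, hWW, Matrix.one_mul] at h
    rw [Matrix.mul_assoc W W ρ] at h
    rw [eq_sub_iff_add_eq] at h ⊢
    rw [add_comm]; exact h
  have hWHWρ : Wᴴ * (W * ρ) = ρ := by rw [← Matrix.mul_assoc, hWW', Matrix.one_mul]
  by_cases hσ0 : σ = 0
  · subst hσ0
    -- here `c ^ 2 = 1`, and `(W - c)ᴴ (W - c) ρ = 0`
    have hc2 : (c : ℂ) ^ 2 = 1 := by
      have : c ^ 2 = 1 := by linarith
      exact_mod_cast this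
    have h0 : W * ρ - (c : ℂ) • ρ = 0 := by
      rw [← Matrix.conjTranspose_mul_self_eq_zero, Matrix.conjTranspose_sub,
        Matrix.conjTranspose_smul, Matrix.conjTranspose_mul, hρ.1.1.eq, RCLike.star_def,
        Complex.conj_ofReal]
      simp only [Matrix.sub_mul, Matrix.mul_sub, Matrix.mul_smul, Matrix.smul_mul]
      rw [Matrix.mul_assoc ρ, hWHWρ, Matrix.mul_assoc ρ, hW', Matrix.mul_sub, Matrix.mul_smul]
      linear_combination (norm := module) (-hc2) • (ρ * ρ)
    have h1 : W * ρ = (c : ℂ) • ρ := sub_eq_zero.1 h0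
    exact ⟨ρ, ρ, hρ, hρ, by simp [h1], by simp [h1], rfl⟩
  · have hσC : (σ : ℂ) ≠ 0 := by exact_mod_cast hσ0
    set α : ℂ := c + σ * Complex.I with hα
    set β : ℂ := c - σ * Complex.I with hβ
    have hαβ : α * β = 1 := by rw [hα, hβ]; linear_combination hσ' - (σ : ℂ) ^ 2 * hI
    have hsum : α + β = 2 * c := by rw [hα, hβ]; ring
    have hcα : star α = β := by simp [hα, hβ]; ring
    have hcβ : star β = α := by rw [← hcα, star_star]
    set κ : ℂ := (2 * σ * Complex.I)⁻¹ with hκ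
    have hκα : κ * (α - β) = 1 := by
      rw [hκ, hα, hβ]; field_simp [Complex.I_ne_zero]; ring
    have hcκ : star κ = -κ := by
      rw [hκ]; simp
    have hκ2 : κ * κ * (2 - α ^ 2 - β ^ 2) = -1 := by
      have h1 : 2 - α ^ 2 - β ^ 2 = 4 * (σ : ℂ) ^ 2 := by
        linear_combination (-(α + β + 2 * c)) * hsum + 2 * hαβ - 4 * hσ'
      rw [h1, hκ, ← mul_inv]
      have h2 : 2 * σ * Complex.I * (2 * σ * Complex.I) = -(4 * (σ : ℂ) ^ 2) := by
        linear_combination 4 * (σ : ℂ) ^ 2 * hI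
      rw [h2, inv_neg, neg_mul, inv_mul_cancel₀ (by simpa using hσ0)]
    -- on the range of `ρ`, `A` and `B` are the spectral projections of `W` for `α` and `β`
    set A : Matrix n n ℂ := κ • (W - β • 1) with hA
    set B : Matrix n n ℂ := -κ • (W - α • 1) with hB
    have hAρ : A * ρ = κ • (W * ρ - β • ρ) := by
      rw [hA, Matrix.smul_mul, Matrix.sub_mul, Matrix.smul_mul, Matrix.one_mul]
    have hBρ : B * ρ = -κ • (W * ρ - α • ρ) := by
      rw [hB, Matrix.smul_mul, Matrix.sub_mul, Matrix.smul_mul, Matrix.one_mul]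
    have hWA : W * (A * ρ) = α • (A * ρ) := by
      rw [hAρ, Matrix.mul_smul, Matrix.mul_sub, Matrix.mul_smul, hWWρ, ← hsum]
      linear_combination (norm := module) (κ * hαβ) • ρ
    have hWB : W * (B * ρ) = β • (B * ρ) := by
      rw [hBρ, Matrix.mul_smul, Matrix.mul_sub, Matrix.mul_smul, hWWρ, ← hsum]
      linear_combination (norm := module) (-κ * hαβ) • ρ
    have hABρ : Aᴴ * (A * ρ) + Bᴴ * (B * ρ) = ρ := by
      rw [hAρ, hBρ, hA, hB]
      simp only [Matrix.conjTranspose_smul, Matrix.conjTranspose_sub, Matrix.conjTranspose_one,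
        star_neg, hcκ, hcα, hcβ, Matrix.smul_mul, Matrix.sub_mul, Matrix.mul_smul, Matrix.mul_sub,
        Matrix.one_mul, hWHWρ, hW', ← hsum]
      linear_combination (norm := module) (-hκ2) • ρ
    have hBA : B = 1 - A := by
      rw [hA, hB]
      linear_combination (norm := module) hκα • (1 : Matrix n n ℂ)
    have hdiagA : (A * ρ * Aᴴ).diag = (B * ρ * Bᴴ).diag := by
      have h1 : A * ρ * Aᴴ - B * ρ * Bᴴ = A * ρ + (A * ρ)ᴴ - ρ := by
        rw [hBA, Matrix.conjTranspose_sub, Matrix.conjTranspose_one, Matrix.conjTranspose_mul,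
          hρ.1.1.eq]
        simp only [Matrix.sub_mul, Matrix.mul_sub, Matrix.one_mul, Matrix.mul_one]
        abel
      rw [← sub_eq_zero, ← Matrix.diag_sub, h1]
      ext i
      have hr : star (ρ i i) = ρ i i := by
        rw [hρ.diag_eq_re, RCLike.star_def, Complex.conj_ofReal]
      have hw : star ((W * ρ) i i) = (W * ρ) i i := by
        have h2 : (W * ρ) i i + star ((ρ * W) i i) = 2 * c * ρ i i := by
          have h3 := congrFun (congrFun hker i) i
          have h4 : Wᴴ * ρ = (ρ * W)ᴴ := by rw [Matrix.conjTranspose_mul, hρ.1.1.eq]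
          rwa [h4, Matrix.add_apply, Matrix.conjTranspose_apply, Matrix.smul_apply,
            smul_eq_mul] at h3
        have h5 : star ((ρ * W) i i) = (ρ * W) i i := Complex.conj_eq_iff_im.2 (hdiag i)
        rw [h5] at h2
        rw [eq_sub_of_add_eq h2, star_sub, h5, star_mul', star_mul', hr]
        simp
      rw [hAρ, Matrix.diag_apply, Matrix.sub_apply, Matrix.add_apply, Matrix.conjTranspose_apply]
      simp only [Matrix.smul_apply, Matrix.sub_apply, smul_eq_mul, star_mul', star_sub, hw, hr,
        hcκ, hcβ, Pi.zero_apply]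
      linear_combination (ρ i i) * hκα
    have htr : (A * ρ * Aᴴ).trace + (B * ρ * Bᴴ).trace = 1 := by
      rw [Matrix.trace_mul_comm, Matrix.trace_mul_comm (B * ρ), ← Matrix.trace_add, hABρ, hρ.2]
    have htr' : (A * ρ * Aᴴ).trace = (B * ρ * Bᴴ).trace := by
      rw [Matrix.trace, Matrix.trace, hdiagA]
    refine ⟨(2 : ℂ) • (A * ρ * Aᴴ), (2 : ℂ) • (B * ρ * Bᴴ), ⟨?_, ?_⟩, ⟨?_, ?_⟩, ?_, ?_, ?_⟩
    · exact (hρ.1.mul_mul_conjTranspose_same A).smul zero_le_two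
    · rw [Matrix.trace_smul, smul_eq_mul]; linear_combination htr + htr'
    · exact (hρ.1.mul_mul_conjTranspose_same B).smul zero_le_two
    · rw [Matrix.trace_smul, smul_eq_mul]; linear_combination htr - htr'
    · rw [Matrix.mul_smul, ← Matrix.mul_assoc, hWA, Matrix.smul_mul, smul_comm]
    · rw [Matrix.mul_smul, ← Matrix.mul_assoc, hWB, Matrix.smul_mul, smul_comm]
    · rw [Matrix.diag_smul, Matrix.diag_smul, hdiagA]


/-- If `E₀` maximizes `ν(UE)` and `ν(UE₀) > 0`, the eigenspaces of `V = UE₀` for a pair of most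
distant eigenvalues carry states with the same diagonal. The minimax state `ρ` satisfies
`∑ i, |⟨i|ρV|i⟩| ≤ ν(V) ≤ |tr ρV|`; hence all `⟨i|ρV|i⟩` have the same phase, and `ρ` is supported
where the real part of the rotated `V` is minimal. -/
lemma exists_isDiscriminatorPair [Nonempty n] {U : Matrix n n ℂ}
    (hU : U ∈ Matrix.unitaryGroup n ℂ) {E₀ : Matrix n n ℂ} (hE₀ : E₀ ∈ diagonalUnitaries n)
    (hmax : ∀ E ∈ diagonalUnitaries n, nu 1 (U * E) ≤ nu 1 (U * E₀))
    (hc : 0 < nu 1 (U * E₀)) {a b : ℂ} (hab : IsMostDistantPair (U * E₀) a b) :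
    ∃ ρ₁ ρ₂ : Matrix n n ℂ, IsDiscriminatorPair (U * E₀) a b ρ₁ ρ₂ := by
  obtain ⟨ρ, hρ, hsum⟩ := exists_isDensity_sum_norm_le hU hc.le hmax
  obtain ⟨u, σ, hu, hσ, hua, hub, hpos⟩ := exists_phase_of_isMostDistantPair
    (mul_mem hU hE₀.1) hc hab
  obtain ⟨e, he, rfl⟩ := mem_diagonalUnitaries_iff.1 hE₀
  set V := U * Matrix.diagonal e with hVdef
  have hV : V ∈ Matrix.unitaryGroup n ℂ := mul_mem hU hE₀.1
  set c := nu 1 V with hcdef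
  set W := u • V with hWdef
  have huu : star u * u = 1 := by rw [RCLike.star_def, Complex.conj_mul', hu]; simp
  have hW : W ∈ Matrix.unitaryGroup n ℂ := by
    rw [Matrix.mem_unitaryGroup_iff', hWdef, star_smul, Matrix.smul_mul, Matrix.mul_smul,
      smul_smul, huu, one_smul, Matrix.mem_unitaryGroup_iff'.1 hV]
  have hnorm : ∀ i, ‖(ρ * W) i i‖ = ‖(ρ * U) i i‖ := by
    intro i
    rw [hWdef, Matrix.mul_smul, Matrix.smul_apply, norm_smul, hu, one_mul, hVdef,
      ← Matrix.mul_assoc, Matrix.mul_diagonal, norm_mul, he, mul_one]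
  have htrace : (ρ * (W + Wᴴ - (2 * c : ℂ) • 1)).trace =
      ((2 * ((∑ i, ((ρ * W) i i).re) - c) : ℝ) : ℂ) := by
    have h1 : (ρ * Wᴴ).trace = star (ρ * W).trace := by
      rw [← Matrix.trace_conjTranspose, Matrix.conjTranspose_mul, hρ.1.1.eq, Matrix.trace_mul_comm]
    rw [Matrix.mul_sub, Matrix.mul_add, Matrix.trace_sub, Matrix.trace_add, h1,
      Matrix.mul_smul ρ (2 * c : ℂ) 1, Matrix.mul_one, Matrix.trace_smul, hρ.2, RCLike.star_def,
      Complex.add_conj]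
    simp [Matrix.trace]
    ring
  have hge : c ≤ ∑ i, ((ρ * W) i i).re := by
    have h1 := trace_mul_nonneg_of_posSemidef hρ.1 hpos
    rw [htrace] at h1
    have := Complex.zero_le_real.1 h1
    linarith
  have hle : ∑ i, ‖(ρ * W) i i‖ ≤ c := by simpa only [hnorm] using hsum
  have hle' : ∑ i, ((ρ * W) i i).re ≤ ∑ i, ‖(ρ * W) i i‖ :=
    Finset.sum_le_sum fun i _ => Complex.re_le_norm _
  have heq : ∀ i, ((ρ * W) i i).re = ‖(ρ * W) i i‖ := fun i =>
    (Finset.sum_eq_sum_iff_of_le fun i _ => Complex.re_le_norm _).1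
      (le_antisymm hle' (hle.trans hge)) i (Finset.mem_univ i)
  have hdiag : ∀ i, ((ρ * W) i i).im = 0 := by
    intro i
    have h1 := Complex.sq_norm ((ρ * W) i i)
    rw [← heq, Complex.normSq_apply] at h1
    have h2 : ((ρ * W) i i).im * ((ρ * W) i i).im = 0 := by linarith
    exact mul_self_eq_zero.1 h2
  have hker : (W + Wᴴ - (2 * c : ℂ) • 1) * ρ = 0 := by
    refine mul_eq_zero_of_trace_eq_zero hρ.1 hpos ?_
    rw [htrace, le_antisymm (hle'.trans hle) hge, sub_self, mul_zero, Complex.ofReal_zero]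
  rw [Matrix.sub_mul, Matrix.add_mul, Matrix.smul_mul (2 * c : ℂ) 1 ρ, Matrix.one_mul,
    sub_eq_zero] at hker
  obtain ⟨ρ₁, ρ₂, h1, h2, h3, h4, h5⟩ := exists_split_of_real_diag hW hρ hσ hker hdiag
  have hback : ∀ (τ : Matrix n n ℂ) (z : ℂ), W * τ = (u * z) • τ → V * τ = z • τ := by
    intro τ z h
    have h6 := congrArg (star u • ·) h
    simp only [hWdef, Matrix.smul_mul, smul_smul, ← mul_assoc, huu, one_mul, one_smul] at h6
    exact h6
  exact ⟨ρ₁, ρ₂, h1, h2, hback ρ₁ a (by rw [h3, hua]), hback ρ₂ b (by rw [h4, hub]), h5⟩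

/-! ### Measurement channels as pinchings -/

/-- The block-diagonal part of a matrix on `ℂⁿ ⊗ ℂᵐ` with respect to the first factor. -/
def pinch (X : Matrix (n × m) (n × m) ℂ) : Matrix (n × m) (n × m) ℂ :=
  Matrix.of fun x y => if x.1 = y.1 then X x y else 0

lemma pinch_apply (X : Matrix (n × m) (n × m) ℂ) (x y : n × m) :
    pinch X x y = if x.1 = y.1 then X x y else 0 := rfl

lemma pinch_one : pinch (1 : Matrix (n × m) (n × m) ℂ) = 1 := by
  ext x y
  rw [pinch_apply, Matrix.one_apply]
  by_cases h : x = y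
  · simp [h]
  · simp [h]

lemma pinch_sub (X Y : Matrix (n × m) (n × m) ℂ) : pinch (X - Y) = pinch X - pinch Y := by
  ext x y
  simp only [pinch_apply, Matrix.sub_apply]
  split_ifs <;> simp

lemma trace_mul_pinch (X Y : Matrix (n × m) (n × m) ℂ) :
    (X * pinch Y).trace = (pinch X * Y).trace := by
  simp only [Matrix.trace, Matrix.diag_apply, Matrix.mul_apply, pinch_apply]
  refine Finset.sum_congr rfl fun x _ => Finset.sum_congr rfl fun y _ => ?_
  by_cases h : x.1 = y.1
  · rw [if_pos h, if_pos h.symm]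
  · rw [if_neg h, if_neg (Ne.symm h), mul_zero, zero_mul]

lemma pinch_eq_sum (X : Matrix (n × m) (n × m) ℂ) :
    pinch X = ∑ i, (Matrix.diagonal fun x : n × m => if x.1 = i then (1 : ℂ) else 0) * X *
      (Matrix.diagonal fun x : n × m => if x.1 = i then (1 : ℂ) else 0)ᴴ := by
  ext x y
  rw [Matrix.sum_apply, pinch_apply]
  simp only [Matrix.diagonal_conjTranspose, Matrix.mul_diagonal, Matrix.diagonal_mul]
  rw [Finset.sum_eq_single x.1]
  · by_cases h : x.1 = y.1
    · simp [h]
    · simp [h, Ne.symm h]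
  · intro i _ hi
    simp [Ne.symm hi]
  · simp

lemma posSemidef_pinch {X : Matrix (n × m) (n × m) ℂ} (hX : X.PosSemidef) :
    (pinch X).PosSemidef := by
  rw [pinch_eq_sum]
  exact Matrix.posSemidef_sum _ fun i _ => hX.mul_mul_conjTranspose_same _

lemma IsEffect.pinch {X : Matrix (n × m) (n × m) ℂ} (hX : IsEffect X) :
    IsEffect (QuantumCertification.pinch X) :=
  ⟨posSemidef_pinch hX.1, by
    rw [← pinch_one, ← pinch_sub]; exact posSemidef_pinch hX.2⟩

lemma kronecker_one_mem_unitaryGroup {V : Matrix n n ℂ} (hV : V ∈ Matrix.unitaryGroup n ℂ) :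
    Vᴴ ⊗ₖ (1 : Matrix m m ℂ) ∈ Matrix.unitaryGroup (n × m) ℂ := by
  rw [Matrix.mem_unitaryGroup_iff, Matrix.star_eq_conjTranspose, Matrix.conjTranspose_kronecker,
    ← Matrix.mul_kronecker_mul, Matrix.conjTranspose_conjTranspose, Matrix.conjTranspose_one,
    Matrix.mul_one, ← Matrix.star_eq_conjTranspose, Matrix.mem_unitaryGroup_iff'.1 hV,
    Matrix.one_kronecker_one]

lemma kronecker_one_mulVec (X : Matrix n n ℂ) (ψ : n × m → ℂ) (x : n × m) :
    ((X ⊗ₖ (1 : Matrix m m ℂ)) *ᵥ ψ) x = ∑ l, X x.1 l * ψ (l, x.2) := by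
  rw [Matrix.mulVec, dotProduct, Fintype.sum_prod_type]
  refine Finset.sum_congr rfl fun l _ => ?_
  rw [Finset.sum_eq_single x.2]
  · simp [Matrix.kroneckerMap_apply]
  · intro j _ hj
    simp [Matrix.kroneckerMap_apply, Ne.symm hj]
  · simp

/-- The measurement `P_U ⊗ 1` rotates by `U† ⊗ 1` and then dephases the first factor. -/
lemma extend_vonNeumann_proj (U : Matrix n n ℂ) (ψ : n × m → ℂ) :
    extend (vonNeumann U) (proj ψ) = pinch (proj ((Uᴴ ⊗ₖ (1 : Matrix m m ℂ)) *ᵥ ψ)) := by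
  ext x y
  rw [pinch_apply]
  simp only [extend, vonNeumann, LinearMap.coe_mk, AddHom.coe_mk, Matrix.of_apply]
  rw [Matrix.sum_apply]
  simp only [Matrix.smul_apply, Matrix.single_apply, smul_eq_mul]
  by_cases h : x.1 = y.1
  · rw [if_pos h, Finset.sum_eq_single x.1]
    · rw [if_pos ⟨rfl, h⟩, mul_one, proj, proj, Matrix.vecMulVec_apply, Pi.star_apply,
        kronecker_one_mulVec, kronecker_one_mulVec, ← h, star_sum, Finset.sum_mul, dotProduct]
      refine Finset.sum_congr rfl fun l _ => ?_
      rw [Matrix.mulVec, dotProduct, Finset.mul_sum, Finset.mul_sum]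
      refine Finset.sum_congr rfl fun k _ => ?_
      simp only [Pi.star_apply, Matrix.of_apply, Matrix.vecMulVec_apply, Matrix.col_apply,
        Matrix.conjTranspose_apply, star_mul', star_star]
      ring
    · intro i _ hi
      rw [if_neg (fun h' => hi h'.1), mul_zero]
    · simp
  · rw [if_neg h]
    refine Finset.sum_eq_zero fun i _ => ?_
    rw [if_neg (fun h' => h (h'.1.symm.trans h'.2)), mul_zero]

lemma trace_mul_proj (X : Matrix n n ℂ) (ψ : n → ℂ) :
    (X * proj ψ).trace = star ψ ⬝ᵥ (X *ᵥ ψ) := by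
  rw [Matrix.trace_mul_comm, trace_proj_mul]

lemma acceptProb_extend_vonNeumann (U : Matrix n n ℂ) (ψ : n × m → ℂ)
    (Ω : Matrix (n × m) (n × m) ℂ) :
    acceptProb Ω (extend (vonNeumann U) (proj ψ)) =
      (star ((Uᴴ ⊗ₖ (1 : Matrix m m ℂ)) *ᵥ ψ) ⬝ᵥ
        (pinch Ω *ᵥ ((Uᴴ ⊗ₖ (1 : Matrix m m ℂ)) *ᵥ ψ))).re := by
  rw [acceptProb, extend_vonNeumann_proj, trace_mul_pinch, trace_mul_proj]

lemma rejectProb_eq (Ω σ : Matrix n n ℂ) : rejectProb Ω σ = σ.trace.re - acceptProb Ω σ := by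
  rw [rejectProb, acceptProb, Matrix.sub_mul, Matrix.one_mul, Matrix.trace_sub, Complex.sub_re]

lemma trace_extend_vonNeumann {U : Matrix n n ℂ} (hU : U ∈ Matrix.unitaryGroup n ℂ)
    {ψ : n × m → ℂ} (hψ : IsUnitVec ψ) : (extend (vonNeumann U) (proj ψ)).trace = 1 := by
  have h := IsUnitVec.mulVec (kronecker_one_mem_unitaryGroup (m := m) hU) hψ
  rw [extend_vonNeumann_proj, ← Matrix.one_mul (pinch _), trace_mul_pinch, pinch_one,
    Matrix.one_mul, h.isDensity_proj.2]

/-- Multiplying the columns of `U` by phases does not change the measurement. -/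
lemma vonNeumann_mul_of_mem_diagonalUnitaries (U : Matrix n n ℂ) {E : Matrix n n ℂ}
    (hE : E ∈ diagonalUnitaries n) : vonNeumann (U * E) = vonNeumann U := by
  obtain ⟨e, he, rfl⟩ := mem_diagonalUnitaries_iff.1 hE
  ext1 ρ
  simp only [vonNeumann, LinearMap.coe_mk, AddHom.coe_mk]
  refine Finset.sum_congr rfl fun i _ => ?_
  congr 1
  have hcol : (U * Matrix.diagonal e).col i = e i • U.col i := by
    ext j
    simp [Matrix.mul_diagonal, mul_comm]
  have hee : star (e i) * e i = 1 := by rw [RCLike.star_def, Complex.conj_mul', he]; simp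
  rw [hcol, star_smul, Matrix.mulVec_smul, smul_dotProduct, dotProduct_smul, smul_smul, hee,
    one_smul]

lemma star_dotProduct_kronecker_one_mulVec (X : Matrix n n ℂ) (ψ : n × m → ℂ) :
    star ψ ⬝ᵥ ((X ⊗ₖ (1 : Matrix m m ℂ)) *ᵥ ψ) =
      ((Matrix.of fun i j => ψ (i, j)) * (Matrix.of fun i j => ψ (i, j))ᴴ * X).trace := by
  rw [dotProduct, Fintype.sum_prod_type, Matrix.trace_mul_comm, Matrix.trace]
  refine Finset.sum_congr rfl fun i _ => ?_
  rw [Matrix.diag_apply, Matrix.mul_apply]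
  simp only [kronecker_one_mulVec, Pi.star_apply, Matrix.mul_apply, Matrix.of_apply,
    Matrix.conjTranspose_apply, Finset.mul_sum]
  rw [Finset.sum_comm]
  exact Finset.sum_congr rfl fun l _ => Finset.sum_congr rfl fun j _ => by ring

lemma nu_one_le_norm_overlap [Nonempty n] {V : Matrix n n ℂ} (hV : V ∈ Matrix.unitaryGroup n ℂ)
    {ψ : n × m → ℂ} (hψ : IsUnitVec ψ) :
    nu 1 V ≤ ‖star ((Vᴴ ⊗ₖ (1 : Matrix m m ℂ)) *ᵥ ψ) ⬝ᵥ ψ‖ := by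
  have hρ : IsDensity ((Matrix.of fun i j => ψ (i, j)) * (Matrix.of fun i j => ψ (i, j))ᴴ) := by
    refine ⟨Matrix.posSemidef_self_mul_conjTranspose _, ?_⟩
    have h := star_dotProduct_kronecker_one_mulVec 1 ψ
    rw [Matrix.one_kronecker_one, Matrix.one_mulVec, Matrix.mul_one] at h
    rw [← h]
    exact hψ
  have h := nu_one_le_norm_trace hV hρ
  rw [← star_dotProduct_kronecker_one_mulVec, star_dotProduct_mulVec,
    Matrix.conjTranspose_kronecker, Matrix.conjTranspose_one] at h
  exact h

/-- The lower bound: for every diagonal unitary `E`, an admissible strategy has a type II error of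
at least `ν_q(UE)²` with `q = √(1-δ)`, as it tests two pure states with overlap at least `ν(UE)`. -/
lemma tradeoff_sq_le_typeIIError [Nonempty n] {U : Matrix n n ℂ}
    (hU : U ∈ Matrix.unitaryGroup n ℂ) {E : Matrix n n ℂ} (hE : E ∈ diagonalUnitaries n)
    {δ : ℝ} (hδ : δ ≤ 1) {ψ : n × m → ℂ} {Ω : Matrix (n × m) (n × m) ℂ}
    (h : IsStrategy (vonNeumann 1) δ ψ Ω) :
    tradeoff √(1 - δ) (nu 1 (U * E)) ^ 2 ≤ typeIIError (vonNeumann U) ψ Ω := by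
  obtain ⟨hψ, hΩ, hI⟩ := h
  have hV := mul_mem hU hE.1
  rw [← vonNeumann_mul_of_mem_diagonalUnitaries U hE, typeIIError, acceptProb_extend_vonNeumann]
  rw [typeIError, rejectProb_eq, trace_extend_vonNeumann (one_mem _) hψ,
    acceptProb_extend_vonNeumann, Matrix.conjTranspose_one, Matrix.one_kronecker_one,
    Matrix.one_mulVec, Complex.one_re] at hI
  refine le_trans ?_ (tradeoff_sq_le_of_isEffect hΩ.pinch
    (IsUnitVec.mulVec (kronecker_one_mem_unitaryGroup hV) hψ) hψ (Real.sqrt_nonneg (1 - δ)) ?_)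
  · have h1 := tradeoff_mono (Real.sqrt_nonneg (1 - δ)) (nu_one_nonneg _)
      (nu_one_le_norm_overlap hV hψ)
    gcongr
    exact tradeoff_nonneg _ _
  · rw [Real.sq_sqrt (by linarith)]
    linarith

/-! ### Orthogonal output states -/

lemma isHermitian_extend_vonNeumann (U : Matrix n n ℂ) (ψ : n × m → ℂ) :
    (extend (vonNeumann U) (proj ψ)).IsHermitian := by
  rw [extend_vonNeumann_proj]
  exact (posSemidef_pinch (Matrix.posSemidef_vecMulVec_self_star _)).1

lemma isOptimalStrategy_of_mul_eq_zero [Nonempty n] {U : Matrix n n ℂ}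
    (hU : U ∈ Matrix.unitaryGroup n ℂ) {δ : ℝ} (hδ : 0 ≤ δ) (hδ1 : δ ≤ 1) {ψ : n × m → ℂ}
    (hψ : IsUnitVec ψ)
    (h : extend (vonNeumann 1) (proj ψ) * extend (vonNeumann U) (proj ψ) = 0)
    {Ω : Matrix (n × m) (n × m) ℂ} (hΩ : IsSupportProjection (extend (vonNeumann 1) (proj ψ)) Ω) :
    IsOptimalStrategy (vonNeumann 1) (vonNeumann U) δ ψ Ω ∧
      typeIIError (vonNeumann U) ψ Ω = 0 := by
  obtain ⟨hH, hP, hrange⟩ := hΩ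
  set σ := extend (vonNeumann (1 : Matrix n n ℂ)) (proj ψ) with hσ
  set τ := extend (vonNeumann U) (proj ψ) with hτ
  have hΩσ : Ω * σ = σ := by
    refine Matrix.toLin'.injective (LinearMap.ext fun v => ?_)
    have hmem : σ *ᵥ v ∈ LinearMap.range Ω.mulVecLin := by
      rw [hrange]; exact ⟨v, rfl⟩
    obtain ⟨w, hw⟩ := hmem
    rw [Matrix.mulVecLin_apply] at hw
    rw [Matrix.toLin'_apply, Matrix.toLin'_apply, ← Matrix.mulVec_mulVec, ← hw,
      Matrix.mulVec_mulVec, hP]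
  have hτσ : τ * σ = 0 := by
    have h1 := congrArg Matrix.conjTranspose h
    rwa [Matrix.conjTranspose_mul, (isHermitian_extend_vonNeumann _ _).eq,
      (isHermitian_extend_vonNeumann _ _).eq, Matrix.conjTranspose_zero] at h1
  have hτΩ : τ * Ω = 0 := by
    refine Matrix.toLin'.injective (LinearMap.ext fun v => ?_)
    have hmem : Ω *ᵥ v ∈ LinearMap.range σ.mulVecLin := by
      rw [← hrange]; exact ⟨v, rfl⟩
    obtain ⟨w, hw⟩ := hmem
    rw [Matrix.mulVecLin_apply] at hw
    rw [Matrix.toLin'_apply, Matrix.toLin'_apply, ← Matrix.mulVec_mulVec, ← hw,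
      Matrix.mulVec_mulVec, hτσ, Matrix.zero_mulVec, Matrix.zero_mulVec]
  have hI : typeIError (vonNeumann 1) ψ Ω = 0 := by
    rw [typeIError, rejectProb, ← hσ, Matrix.sub_mul, Matrix.one_mul, hΩσ, sub_self,
      Matrix.trace_zero, Complex.zero_re]
  have hII : typeIIError (vonNeumann U) ψ Ω = 0 := by
    rw [typeIIError, acceptProb, ← hτ, Matrix.trace_mul_comm, hτΩ, Matrix.trace_zero,
      Complex.zero_re]
  refine ⟨⟨⟨hψ, isEffect_of_isHermitian_of_mul_self hH hP, hI.trans_le hδ⟩, ?_⟩, hII⟩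
  rintro p ⟨k, ψ', Ω', hs, rfl⟩
  rw [hII]
  have hE : (1 : Matrix n n ℂ) ∈ diagonalUnitaries n := ⟨one_mem _, Matrix.isDiag_one⟩
  exact (sq_nonneg _).trans (tradeoff_sq_le_typeIIError hU hE hδ1 hs)

lemma isUnitVec_inputState {S : Matrix n n ℂ} (hS : S.IsHermitian) (h : (S * S).trace = 1) :
    IsUnitVec (inputState S) := by
  rw [IsUnitVec, ← h, dotProduct, Fintype.sum_prod_type, Matrix.trace]
  refine Finset.sum_congr rfl fun i _ => ?_
  rw [Matrix.diag_apply, Matrix.mul_apply]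
  refine Finset.sum_congr rfl fun j _ => ?_
  change star (S i j) * S i j = S i j * S j i
  rw [hS.apply j i, mul_comm]

/-- The output vector of the input state `∑ i, S|i⟩ ⊗ |i⟩`: its block `i` is the entrywise conjugate
of `SU|i⟩`. -/
lemma kronecker_one_mulVec_inputState {S : Matrix n n ℂ} (hS : S.IsHermitian) (U : Matrix n n ℂ)
    (i j : n) :
    ((Uᴴ ⊗ₖ (1 : Matrix n n ℂ)) *ᵥ inputState S) (i, j) = star ((S * U) j i) := by
  rw [kronecker_one_mulVec, Matrix.mul_apply, star_sum]
  refine Finset.sum_congr rfl fun l _ => ?_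
  rw [star_mul', Matrix.conjTranspose_apply, hS.apply, mul_comm]
  simp [inputState]

lemma extend_mul_extend_eq_zero {S U : Matrix n n ℂ} (hS : S.IsHermitian)
    (h : ∀ i, (S * S * U) i i = 0) :
    extend (vonNeumann 1) (proj (inputState S)) * extend (vonNeumann U) (proj (inputState S)) =
      0 := by
  rw [extend_vonNeumann_proj, extend_vonNeumann_proj]
  ext ⟨i, j⟩ ⟨i', k⟩
  rw [Matrix.mul_apply, Fintype.sum_prod_type, Finset.sum_eq_single i]
  · simp only [pinch_apply, if_true, proj, Matrix.vecMulVec_apply, Pi.star_apply,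
      kronecker_one_mulVec_inputState hS, Matrix.mul_one, star_star, Matrix.zero_apply]
    by_cases hi : i = i'
    · subst hi
      simp only [if_true]
      have h1 : ∑ b, S b i * star ((S * U) b i) = 0 := by
        have h2 := congrArg star (h i)
        rw [Matrix.mul_assoc, Matrix.mul_apply, star_sum, star_zero] at h2
        rw [← h2]
        refine Finset.sum_congr rfl fun b _ => ?_
        rw [star_mul', hS.apply]
      calc ∑ b, star (S j i) * S b i * (star ((S * U) b i) * (S * U) k i)
          = star (S j i) * (S * U) k i * ∑ b, S b i * star ((S * U) b i) := by
            rw [Finset.mul_sum]; exact Finset.sum_congr rfl fun b _ => by ring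
        _ = 0 := by rw [h1, mul_zero]
    · simp [hi]
  · intro a _ ha
    refine Finset.sum_eq_zero fun b _ => ?_
    rw [pinch_apply, if_neg (Ne.symm ha), zero_mul]
  · simp

/-- If `ν(UE) = 0` for all diagonal unitaries `E`, the minimax state `ρ` satisfies `⟨i|ρU|i⟩ = 0`
for all `i`, so the input state given by `√ρ` has orthogonal outputs. -/
lemma exists_isUnitVec_extend_mul_eq_zero [Nonempty n] {U : Matrix n n ℂ}
    (hU : U ∈ Matrix.unitaryGroup n ℂ) (h : ∀ E ∈ diagonalUnitaries n, nu 1 (U * E) = 0) :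
    ∃ ψ : n × n → ℂ, IsUnitVec ψ ∧
      extend (vonNeumann 1) (proj ψ) * extend (vonNeumann U) (proj ψ) = 0 := by
  obtain ⟨ρ, hρ, hsum⟩ := exists_isDensity_sum_norm_le hU le_rfl fun E hE => (h E hE).le
  obtain ⟨S, hS, rfl⟩ := exists_posSemidef_mul_self hρ.1
  refine ⟨inputState S, isUnitVec_inputState hS.1 hρ.2, extend_mul_extend_eq_zero hS.1 fun i => ?_⟩
  have h1 := (Finset.single_le_sum (f := fun i => ‖(S * S * U) i i‖) (fun i _ => norm_nonneg _)
    (Finset.mem_univ i)).trans hsum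
  exact norm_le_zero_iff.1 h1

lemma exists_isSupportProjection {σ : Matrix n n ℂ} (hσ : σ.IsHermitian) :
    ∃ P : Matrix n n ℂ, IsSupportProjection σ P := by
  set Q : Matrix n n ℂ := (hσ.eigenvectorUnitary : Matrix n n ℂ) with hQ
  have hQQ : Qᴴ * Q = 1 := Matrix.mem_unitaryGroup_iff'.1 hσ.eigenvectorUnitary.2
  set l : n → ℂ := fun i => (hσ.eigenvalues i : ℂ) with hl
  have hspec : σ = Q * Matrix.diagonal l * Qᴴ := hσ.spectral_theorem
  set D : Matrix n n ℂ := Matrix.diagonal fun i => if l i = 0 then 0 else 1 with hD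
  set D' : Matrix n n ℂ := Matrix.diagonal fun i => (l i)⁻¹ with hD'
  have hDl : D * Matrix.diagonal l = Matrix.diagonal l := by
    rw [hD, Matrix.diagonal_mul_diagonal]
    congr 1; ext i; by_cases h : l i = 0 <;> simp [h]
  have hlD : Matrix.diagonal l * D' = D := by
    rw [hD, hD', Matrix.diagonal_mul_diagonal]
    congr 1; ext i; by_cases h : l i = 0 <;> simp [h]
  have hDD : D * D = D := by
    rw [hD, Matrix.diagonal_mul_diagonal]
    congr 1; ext i; by_cases h : l i = 0 <;> simp [h]
  have hmul : ∀ X Y : Matrix n n ℂ, Q * X * Qᴴ * (Q * Y * Qᴴ) = Q * (X * Y) * Qᴴ := by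
    intro X Y
    calc _ = Q * (X * ((Qᴴ * Q) * Y)) * Qᴴ := by simp only [Matrix.mul_assoc]
      _ = _ := by rw [hQQ, Matrix.one_mul]
  refine ⟨Q * D * Qᴴ, ?_, ?_, le_antisymm ?_ ?_⟩
  · refine Matrix.isHermitian_mul_mul_conjTranspose Q ?_
    rw [hD, Matrix.IsHermitian, Matrix.diagonal_conjTranspose]
    congr 1; ext i; by_cases h : l i = 0 <;> simp [h]
  · rw [hmul, hDD]
  · rintro _ ⟨v, rfl⟩
    refine ⟨(Q * D' * Qᴴ) *ᵥ v, ?_⟩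
    rw [Matrix.mulVecLin_apply, Matrix.mulVecLin_apply, Matrix.mulVec_mulVec]
    nth_rewrite 1 [hspec]
    rw [hmul, hlD]
  · rintro _ ⟨v, rfl⟩
    refine ⟨σ *ᵥ v, ?_⟩
    rw [Matrix.mulVecLin_apply, Matrix.mulVecLin_apply, Matrix.mulVec_mulVec]
    nth_rewrite 1 [hspec]
    rw [hmul, hDl, ← hspec]

/-! ### Most powerful tests of pure states -/

lemma acceptProb_proj (Ω : Matrix n n ℂ) (x : n → ℂ) :
    acceptProb Ω (proj x) = (star x ⬝ᵥ (Ω *ᵥ x)).re := by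
  rw [acceptProb, trace_mul_proj]

lemma IsUnitVec.rejectProb_proj (Ω : Matrix n n ℂ) {y : n → ℂ} (hy : IsUnitVec y) :
    rejectProb Ω (proj y) = 1 - (star y ⬝ᵥ (Ω *ᵥ y)).re := by
  rw [rejectProb_eq, hy.isDensity_proj.2, acceptProb_proj, Complex.one_re]

lemma exists_isMostPowerful_proj [Nontrivial n] {δ : ℝ} (hδ : 0 ≤ δ) (hδ1 : δ ≤ 1) {x y : n → ℂ}
    (hx : IsUnitVec x) (hy : IsUnitVec y) :
    ∃ Ω : Matrix n n ℂ, IsMostPowerful δ (proj y) (proj x) Ω ∧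
      acceptProb Ω (proj x) = tradeoff √(1 - δ) ‖star x ⬝ᵥ y‖ ^ 2 := by
  have hq : √(1 - δ) ^ 2 = 1 - δ := Real.sq_sqrt (by linarith)
  obtain ⟨φ, hφ, h1, h2⟩ := exists_isUnitVec_tradeoff hx hy (Real.sqrt_nonneg (1 - δ))
    (Real.sqrt_le_one.2 (by linarith))
  have hval : acceptProb (proj φ) (proj x) = tradeoff √(1 - δ) ‖star x ⬝ᵥ y‖ ^ 2 := by
    rw [acceptProb_proj, star_dotProduct_proj_mulVec, Complex.ofReal_re, h2]
  refine ⟨proj φ, ⟨⟨IsUnitVec.isEffect_proj hφ, ?_⟩, ?_⟩, hval⟩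
  · rw [hy.rejectProb_proj, star_dotProduct_proj_mulVec, Complex.ofReal_re]
    have h3 : √(1 - δ) ^ 2 ≤ ‖star y ⬝ᵥ φ‖ ^ 2 := by gcongr
    linarith
  · intro Ω' hΩ' hrej
    rw [hval, acceptProb_proj]
    rw [hy.rejectProb_proj] at hrej
    exact tradeoff_sq_le_of_isEffect hΩ' hx hy (Real.sqrt_nonneg _) (by linarith)

lemma exists_isUnitVec_smul_proj_eq {v : n → ℂ} {r : ℝ} (hr : 0 < r)
    (hv : star v ⬝ᵥ v = (r : ℂ)) :
    IsUnitVec (((√r : ℝ) : ℂ)⁻¹ • v) ∧ proj (((√r : ℝ) : ℂ)⁻¹ • v) = (r : ℂ)⁻¹ • proj v := by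
  have hs : star (((√r : ℝ) : ℂ)⁻¹) * ((√r : ℝ) : ℂ)⁻¹ = (r : ℂ)⁻¹ := by
    rw [RCLike.star_def, map_inv₀, Complex.conj_ofReal, ← mul_inv, ← Complex.ofReal_mul,
      Real.mul_self_sqrt hr.le]
  have hrC : (r : ℂ) ≠ 0 := by exact_mod_cast hr.ne'
  constructor
  · rw [IsUnitVec, star_smul, smul_dotProduct, dotProduct_smul, hv, smul_smul, hs, smul_eq_mul,
      inv_mul_cancel₀ hrC]
  · rw [proj, star_smul, Matrix.smul_vecMulVec, Matrix.vecMulVec_smul, smul_smul, mul_comm, hs,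
      proj]

/-! ### Labelled measurements -/

lemma labelledMeasurement_apply (Ω : n → Matrix n n ℂ) (x y : n × n) :
    labelledMeasurement Ω x y = if x.1 = y.1 then Ω x.1 y.2 x.2 else 0 := by
  rw [labelledMeasurement, Matrix.sum_apply]
  simp only [Matrix.kroneckerMap_apply, Matrix.transpose_apply, Matrix.single_apply]
  by_cases h : x.1 = y.1
  · rw [if_pos h, Finset.sum_eq_single x.1]
    · rw [if_pos ⟨rfl, h⟩, one_mul]
    · intro i _ hi
      rw [if_neg fun h' => hi h'.1, zero_mul]
    · simp
  · rw [if_neg h]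
    refine Finset.sum_eq_zero fun i _ => ?_
    rw [if_neg fun h' => h (h'.1.symm.trans h'.2), zero_mul]

lemma posSemidef_labelledMeasurement {Ω : n → Matrix n n ℂ} (h : ∀ i, (Ω i).PosSemidef) :
    (labelledMeasurement Ω).PosSemidef := by
  refine Matrix.posSemidef_sum _ fun i _ => Matrix.PosSemidef.kronecker ?_ (h i).transpose
  rw [← Matrix.diagonal_single]
  exact Matrix.PosSemidef.diagonal (Pi.single_nonneg.2 zero_le_one)

lemma isEffect_labelledMeasurement {Ω : n → Matrix n n ℂ} (h : ∀ i, IsEffect (Ω i)) :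
    IsEffect (labelledMeasurement Ω) := by
  refine ⟨posSemidef_labelledMeasurement fun i => (h i).1, ?_⟩
  have h1 : 1 - labelledMeasurement Ω = labelledMeasurement fun i => 1 - Ω i := by
    ext x y
    rw [Matrix.sub_apply, labelledMeasurement_apply, labelledMeasurement_apply, Matrix.one_apply]
    by_cases hx : x.1 = y.1
    · rw [if_pos hx, if_pos hx, Matrix.sub_apply, Matrix.one_apply]
      simp [Prod.ext_iff, hx, eq_comm]
    · rw [if_neg hx, if_neg hx, if_neg (fun h => hx (congrArg Prod.fst h)), sub_zero]
  rw [h1]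
  exact posSemidef_labelledMeasurement fun i => (h i).2

lemma acceptProb_labelledMeasurement {S : Matrix n n ℂ} (hS : S.IsHermitian) (U : Matrix n n ℂ)
    (Ω : n → Matrix n n ℂ) :
    acceptProb (labelledMeasurement Ω) (extend (vonNeumann U) (proj (inputState S))) =
      ∑ i, (star ((S * U).col i) ⬝ᵥ (Ω i *ᵥ (S * U).col i)).re := by
  have hpinch : pinch (labelledMeasurement Ω) = labelledMeasurement Ω := by
    ext x y
    rw [pinch_apply, labelledMeasurement_apply]
    split_ifs <;> rfl
  rw [acceptProb_extend_vonNeumann, hpinch, ← Complex.re_sum]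
  have hx := kronecker_one_mulVec_inputState hS U
  generalize (Uᴴ ⊗ₖ (1 : Matrix n n ℂ)) *ᵥ inputState S = x at hx
  congr 1
  rw [dotProduct, Fintype.sum_prod_type]
  refine Finset.sum_congr rfl fun i _ => ?_
  have hblock : ∀ j, (labelledMeasurement Ω *ᵥ x) (i, j) = ∑ b, Ω i b j * x (i, b) := by
    intro j
    rw [Matrix.mulVec, dotProduct, Fintype.sum_prod_type, Finset.sum_eq_single i]
    · simp only [labelledMeasurement_apply, if_true]
    · intro a _ ha
      simp only [labelledMeasurement_apply, if_neg (Ne.symm ha), zero_mul, Finset.sum_const_zero]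
    · simp
  simp only [hblock, Pi.star_apply, hx, star_star]
  simp only [Matrix.mulVec, dotProduct, Matrix.col_apply, Pi.star_apply, Finset.mul_sum]
  rw [Finset.sum_comm]
  exact Finset.sum_congr rfl fun b _ => Finset.sum_congr rfl fun j _ => by ring

/-! ### The strategy built from a discriminator pair -/

lemma star_col_dotProduct_col (A B : Matrix n n ℂ) (i j : n) :
    star (A.col i) ⬝ᵥ B.col j = (Aᴴ * B) i j := rfl

lemma exists_isMostDistantPair [Nonempty n] {V : Matrix n n ℂ}
    (hV : V ∈ Matrix.unitaryGroup n ℂ) : ∃ a b : ℂ, IsMostDistantPair V a b := by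
  obtain ⟨Q, hQ, l, -, rfl⟩ := exists_unitary_diagonalization hV
  obtain ⟨⟨j, k⟩, h⟩ := Finite.exists_max fun p : n × n => ‖l p.1 - l p.2‖
  have hspec := spectrum_eq_range_of_diagonalization hQ l
  refine ⟨l j, l k, by rw [hspec]; exact ⟨j, rfl⟩, by rw [hspec]; exact ⟨k, rfl⟩, ?_⟩
  rw [hspec]
  rintro _ ⟨j', rfl⟩ _ ⟨k', rfl⟩
  exact h (j', k')

lemma mul_eq_smul_of_unitary {V ρ : Matrix n n ℂ} (hV : V ∈ Matrix.unitaryGroup n ℂ)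
    (hρ : ρ.IsHermitian) {a : ℂ} (ha : ‖a‖ = 1) (h : V * ρ = a • ρ) :
    ρ * V = a • ρ ∧ Vᴴ * ρ * V = ρ := by
  have haa : star a * a = 1 := by rw [RCLike.star_def, Complex.conj_mul', ha]; simp
  have h1 : Vᴴ * ρ = star a • ρ := by
    have h2 := congrArg (fun X => star a • (Vᴴ * X)) h
    simp only [← Matrix.mul_assoc] at h2
    rw [← Matrix.star_eq_conjTranspose, Matrix.mem_unitaryGroup_iff'.1 hV, Matrix.one_mul,
      Matrix.mul_smul, smul_smul, haa, one_smul] at h2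
    exact h2.symm
  have h3 : ρ * V = a • ρ := by
    have h4 := congrArg Matrix.conjTranspose h1
    rwa [Matrix.conjTranspose_mul, Matrix.conjTranspose_conjTranspose, hρ.eq,
      Matrix.conjTranspose_smul, hρ.eq, star_star] at h4
  exact ⟨h3, by rw [h1, Matrix.smul_mul, h3, smul_smul, haa, one_smul]⟩

/-- Conditioned on the label `i`, the strategy given by a discriminator pair tests the vector
`√ρ U|i⟩` against `√ρ|i⟩`. For every `i` both have squared norm `⟨i|ρ|i⟩`, and their normalized
overlap has modulus `ν(UE₀)`. -/
lemma conditional_states [Nonempty n] {U : Matrix n n ℂ} (hU : U ∈ Matrix.unitaryGroup n ℂ)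
    {E₀ : Matrix n n ℂ} (hE₀ : E₀ ∈ diagonalUnitaries n) (hc : 0 < nu 1 (U * E₀)) {a b : ℂ}
    (hab : IsMostDistantPair (U * E₀) a b) {ρ₁ ρ₂ : Matrix n n ℂ}
    (hρ : IsDiscriminatorPair (U * E₀) a b ρ₁ ρ₂) {S : Matrix n n ℂ} (hS : S.PosSemidef)
    (hSS : S * S = (1 / 2 : ℂ) • (ρ₁ + ρ₂)) (i : n) :
    star (S.col i) ⬝ᵥ S.col i = ((ρ₁ i i).re : ℂ) ∧
      star ((S * U).col i) ⬝ᵥ (S * U).col i = ((ρ₁ i i).re : ℂ) ∧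
      ‖star ((S * U).col i) ⬝ᵥ S.col i‖ = nu 1 (U * E₀) * (ρ₁ i i).re := by
  obtain ⟨h1, h2, ha, hb, hdiag⟩ := hρ
  have hV := mul_mem hU hE₀.1
  obtain ⟨hna, hnb, hnab⟩ := norm_add_of_isMostDistantPair hV hc hab
  obtain ⟨e, he, rfl⟩ := mem_diagonalUnitaries_iff.1 hE₀
  set V := U * Matrix.diagonal e with hVdef
  obtain ⟨ha1, ha2⟩ := mul_eq_smul_of_unitary hV h1.1.1 hna ha
  obtain ⟨hb1, hb2⟩ := mul_eq_smul_of_unitary hV h2.1.1 hnb hb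
  have hdi : ρ₂ i i = ρ₁ i i := (congrFun hdiag i).symm
  have hr : ((ρ₁ i i).re : ℂ) = ρ₁ i i := (h1.diag_eq_re i).symm
  have hSSi : (S * S) i i = ρ₁ i i := by
    rw [hSS, Matrix.smul_apply, Matrix.add_apply, hdi, smul_eq_mul]; ring
  have hee : star (e i) * e i = 1 := by rw [RCLike.star_def, Complex.conj_mul', he]; simp
  refine ⟨?_, ?_, ?_⟩
  · rw [star_col_dotProduct_col, hS.1.eq, hSSi, hr]
  · have h3 : Vᴴ * (S * S) * V = S * S := by
      rw [hSS, Matrix.mul_smul, Matrix.smul_mul, Matrix.mul_add, Matrix.add_mul, ha2, hb2]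
    have h4 : (Vᴴ * (S * S) * V) i i = star (e i) * e i * ((S * U)ᴴ * (S * U)) i i := by
      have h5 : Vᴴ * (S * S) * V =
          (Matrix.diagonal e)ᴴ * ((S * U)ᴴ * (S * U)) * Matrix.diagonal e := by
        rw [hVdef, Matrix.conjTranspose_mul, Matrix.conjTranspose_mul S U, hS.1.eq]
        simp only [Matrix.mul_assoc]
      rw [h5, Matrix.mul_diagonal, Matrix.diagonal_conjTranspose, Matrix.diagonal_mul,
        Pi.star_apply]
      ring
    rw [star_col_dotProduct_col, hr, ← hSSi, ← h3, h4, hee, one_mul]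
  · have h3 : (S * S * V) i i = (a + b) / 2 * ρ₁ i i := by
      rw [hSS, Matrix.smul_mul, Matrix.add_mul, ha1, hb1, Matrix.smul_apply, Matrix.add_apply,
        Matrix.smul_apply, Matrix.smul_apply, hdi]
      simp only [smul_eq_mul]
      ring
    rw [norm_star_dotProduct_comm, star_col_dotProduct_col, hS.1.eq, ← Matrix.mul_assoc]
    have h4 : (S * S * V) i i = (S * S * U) i i * e i := by
      rw [hVdef, ← Matrix.mul_assoc, Matrix.mul_diagonal]
    have h5 : ‖(S * S * U) i i‖ = ‖(S * S * V) i i‖ := by rw [h4, norm_mul, he, mul_one]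
    rw [h5, h3, norm_mul, norm_div, hnab, h1.diag_eq_re, Complex.norm_real,
      Real.norm_of_nonneg (h1.diag_re_nonneg i), Complex.ofReal_re]
    simp

/-- The conditional test of the vectors `√ρ|i⟩` and `√ρ U|i⟩`, brought to unit vectors. -/
lemma exists_conditional_unit_states [Nonempty n] {U : Matrix n n ℂ}
    (hU : U ∈ Matrix.unitaryGroup n ℂ)
    {E₀ : Matrix n n ℂ} (hE₀ : E₀ ∈ diagonalUnitaries n) (hc : 0 < nu 1 (U * E₀)) {a b : ℂ}
    (hab : IsMostDistantPair (U * E₀) a b) {ρ₁ ρ₂ : Matrix n n ℂ}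
    (hρ : IsDiscriminatorPair (U * E₀) a b ρ₁ ρ₂) {S : Matrix n n ℂ} (hS : S.PosSemidef)
    (hSS : S * S = (1 / 2 : ℂ) • (ρ₁ + ρ₂)) {i : n}
    (hi : ((1 / 2 : ℂ) • (ρ₁ + ρ₂)) i i ≠ 0) :
    0 < (ρ₁ i i).re ∧ ∃ x y : n → ℂ, IsUnitVec x ∧ IsUnitVec y ∧
      ‖star x ⬝ᵥ y‖ = nu 1 (U * E₀) ∧
      proj y = (((1 / 2 : ℂ) • (ρ₁ + ρ₂)) i i)⁻¹ • proj (S.col i) ∧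
      proj x = (((1 / 2 : ℂ) • (ρ₁ + ρ₂)) i i)⁻¹ • proj ((S * U).col i) ∧
      (∀ Ω : Matrix n n ℂ, (star (S.col i) ⬝ᵥ (Ω *ᵥ S.col i)).re =
        (ρ₁ i i).re * (star y ⬝ᵥ (Ω *ᵥ y)).re) ∧
      (∀ Ω : Matrix n n ℂ, (star ((S * U).col i) ⬝ᵥ (Ω *ᵥ (S * U).col i)).re =
        (ρ₁ i i).re * (star x ⬝ᵥ (Ω *ᵥ x)).re) := by
  obtain ⟨hy, hx, hov⟩ := conditional_states hU hE₀ hc hab hρ hS hSS i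
  have h1 : ((1 / 2 : ℂ) • (ρ₁ + ρ₂)) i i = ((ρ₁ i i).re : ℂ) := by
    rw [← hSS, ← hy, star_col_dotProduct_col, hS.1.eq]
  rw [h1] at hi ⊢
  set r := (ρ₁ i i).re with hr
  have hr0 : 0 < r := lt_of_le_of_ne (hρ.1.diag_re_nonneg i) fun h => hi (by rw [← h]; simp)
  obtain ⟨hyu, hyp⟩ := exists_isUnitVec_smul_proj_eq hr0 hy
  obtain ⟨hxu, hxp⟩ := exists_isUnitVec_smul_proj_eq hr0 hx
  have hs : star (((√r : ℝ) : ℂ)⁻¹) * ((√r : ℝ) : ℂ)⁻¹ = ((r⁻¹ : ℝ) : ℂ) := by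
    rw [RCLike.star_def, map_inv₀, Complex.conj_ofReal, ← mul_inv, ← Complex.ofReal_mul,
      Real.mul_self_sqrt hr0.le, Complex.ofReal_inv]
  have hscale : ∀ (v : n → ℂ) (Ω : Matrix n n ℂ), (star v ⬝ᵥ (Ω *ᵥ v)).re =
      r * (star (((√r : ℝ) : ℂ)⁻¹ • v) ⬝ᵥ (Ω *ᵥ (((√r : ℝ) : ℂ)⁻¹ • v))).re := by
    intro v Ω
    rw [Matrix.mulVec_smul, star_smul, smul_dotProduct, dotProduct_smul, smul_smul, hs,
      smul_eq_mul, Complex.re_ofReal_mul, ← mul_assoc, mul_inv_cancel₀ hr0.ne', one_mul]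
  refine ⟨hr0, _, _, hxu, hyu, ?_, hyp, hxp, hscale _, hscale _⟩
  rw [star_smul, smul_dotProduct, dotProduct_smul, smul_smul, hs, norm_smul, hov,
    Complex.norm_real, Real.norm_of_nonneg (by positivity)]
  field_simp

lemma exists_isConditionalTest [Nontrivial n] {U : Matrix n n ℂ}
    (hU : U ∈ Matrix.unitaryGroup n ℂ) {δ : ℝ} (hδ : 0 ≤ δ) (hδ1 : δ ≤ 1)
    {E₀ : Matrix n n ℂ} (hE₀ : E₀ ∈ diagonalUnitaries n) (hc : 0 < nu 1 (U * E₀)) {a b : ℂ}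
    (hab : IsMostDistantPair (U * E₀) a b) {ρ₁ ρ₂ : Matrix n n ℂ}
    (hρ : IsDiscriminatorPair (U * E₀) a b ρ₁ ρ₂) {S : Matrix n n ℂ} (hS : S.PosSemidef)
    (hSS : S * S = (1 / 2 : ℂ) • (ρ₁ + ρ₂)) :
    ∃ Ω : n → Matrix n n ℂ, IsConditionalTest U δ ((1 / 2 : ℂ) • (ρ₁ + ρ₂)) S Ω := by
  have h : ∀ i, ∃ Ω : Matrix n n ℂ, (((1 / 2 : ℂ) • (ρ₁ + ρ₂)) i i ≠ 0 →
      IsMostPowerful δ ((((1 / 2 : ℂ) • (ρ₁ + ρ₂)) i i)⁻¹ • proj (S.col i))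
        ((((1 / 2 : ℂ) • (ρ₁ + ρ₂)) i i)⁻¹ • proj ((S * U).col i)) Ω) ∧
      (((1 / 2 : ℂ) • (ρ₁ + ρ₂)) i i = 0 → Ω = 0) := by
    intro i
    by_cases hi : ((1 / 2 : ℂ) • (ρ₁ + ρ₂)) i i = 0
    · exact ⟨0, fun h => absurd hi h, fun _ => rfl⟩
    · obtain ⟨-, x, y, hx, hy, -, hyp, hxp, -⟩ :=
        exists_conditional_unit_states hU hE₀ hc hab hρ hS hSS hi
      obtain ⟨Ω, hΩ, -⟩ := exists_isMostPowerful_proj hδ hδ1 hx hy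
      exact ⟨Ω, fun _ => by rw [← hyp, ← hxp]; exact hΩ, fun h => absurd h hi⟩
  choose Ω hΩ using h
  exact ⟨Ω, hΩ⟩

lemma isStrategy_labelledMeasurement [Nontrivial n] {U : Matrix n n ℂ}
    (hU : U ∈ Matrix.unitaryGroup n ℂ) {δ : ℝ} (hδ : 0 ≤ δ) (hδ1 : δ ≤ 1)
    {E₀ : Matrix n n ℂ} (hE₀ : E₀ ∈ diagonalUnitaries n) (hc : 0 < nu 1 (U * E₀)) {a b : ℂ}
    (hab : IsMostDistantPair (U * E₀) a b) {ρ₁ ρ₂ : Matrix n n ℂ}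
    (hρ : IsDiscriminatorPair (U * E₀) a b ρ₁ ρ₂) {S : Matrix n n ℂ} (hS : S.PosSemidef)
    (hSS : S * S = (1 / 2 : ℂ) • (ρ₁ + ρ₂)) {Ω : n → Matrix n n ℂ}
    (hΩ : IsConditionalTest U δ ((1 / 2 : ℂ) • (ρ₁ + ρ₂)) S Ω) :
    IsStrategy (vonNeumann 1) δ (inputState S) (labelledMeasurement Ω) ∧
      typeIIError (vonNeumann U) (inputState S) (labelledMeasurement Ω) ≤
        tradeoff √(1 - δ) (nu 1 (U * E₀)) ^ 2 := by
  have hunit : IsUnitVec (inputState S) := by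
    refine isUnitVec_inputState hS.1 ?_
    rw [hSS, Matrix.trace_smul, Matrix.trace_add, hρ.1.2, hρ.2.1.2, smul_eq_mul]
    norm_num
  have hzero : IsEffect (0 : Matrix n n ℂ) :=
    ⟨Matrix.PosSemidef.zero, by rw [sub_zero]; exact Matrix.PosSemidef.one⟩
  have hterm : ∀ i, IsEffect (Ω i) ∧
      (ρ₁ i i).re * (1 - δ) ≤ (star (S.col i) ⬝ᵥ (Ω i *ᵥ S.col i)).re ∧
      (star ((S * U).col i) ⬝ᵥ (Ω i *ᵥ (S * U).col i)).re ≤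
        (ρ₁ i i).re * tradeoff √(1 - δ) (nu 1 (U * E₀)) ^ 2 := by
    intro i
    by_cases hi : ((1 / 2 : ℂ) • (ρ₁ + ρ₂)) i i = 0
    · have hr : (ρ₁ i i).re = 0 := by
        have h1 := (conditional_states hU hE₀ hc hab hρ hS hSS i).1
        rw [star_col_dotProduct_col, hS.1.eq, hSS, hi] at h1
        exact_mod_cast h1.symm
      rw [(hΩ i).2 hi, hr]
      simp [hzero]
    · obtain ⟨hr, x, y, hx, hy, hov, hyp, hxp, hyΩ, hxΩ⟩ :=
        exists_conditional_unit_states hU hE₀ hc hab hρ hS hSS hi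
      obtain ⟨⟨h1, h2⟩, h3⟩ := (hΩ i).1 hi
      rw [← hyp] at h2 h3
      rw [← hxp] at h3
      obtain ⟨Ω', ⟨⟨h4, h5⟩, -⟩, h6⟩ := exists_isMostPowerful_proj hδ hδ1 hx hy
      refine ⟨h1, ?_, ?_⟩
      · rw [hyΩ]
        rw [hy.rejectProb_proj] at h2
        exact mul_le_mul_of_nonneg_left (by linarith) hr.le
      · rw [hxΩ]
        have h7 := h3 Ω' h4 h5
        rw [h6, hov, acceptProb_proj] at h7
        exact mul_le_mul_of_nonneg_left h7 hr.le
  refine ⟨⟨hunit, isEffect_labelledMeasurement fun i => (hterm i).1, ?_⟩, ?_⟩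
  · rw [typeIError, rejectProb_eq, trace_extend_vonNeumann (one_mem _) hunit,
      acceptProb_labelledMeasurement hS.1, Matrix.mul_one, Complex.one_re]
    have h1 := Finset.sum_le_sum fun i (_ : i ∈ Finset.univ) => (hterm i).2.1
    rw [← Finset.sum_mul, hρ.1.sum_diag_re, one_mul] at h1
    linarith
  · rw [typeIIError, acceptProb_labelledMeasurement hS.1]
    refine (Finset.sum_le_sum fun i _ => (hterm i).2.2).trans (le_of_eq ?_)
    rw [← Finset.sum_mul, hρ.1.sum_diag_re, one_mul]

/-- A strategy attaining `max_E ν_q(UE)²` with `q = √(1-δ)`. -/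
lemma exists_isStrategy_typeIIError_le [Nontrivial n] {U : Matrix n n ℂ}
    (hU : U ∈ Matrix.unitaryGroup n ℂ) {δ : ℝ} (hδ : 0 ≤ δ) (hδ1 : δ ≤ 1)
    {E₀ : Matrix n n ℂ} (hE₀ : E₀ ∈ diagonalUnitaries n)
    (hmax : ∀ E ∈ diagonalUnitaries n, nu 1 (U * E) ≤ nu 1 (U * E₀)) :
    ∃ (ψ : n × n → ℂ) (Ω : Matrix (n × n) (n × n) ℂ), IsStrategy (vonNeumann 1) δ ψ Ω ∧
      typeIIError (vonNeumann U) ψ Ω ≤ tradeoff √(1 - δ) (nu 1 (U * E₀)) ^ 2 := by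
  rcases (nu_one_nonneg (U * E₀)).eq_or_lt with h0 | hc
  · obtain ⟨ψ, hψ, h⟩ := exists_isUnitVec_extend_mul_eq_zero hU fun E hE =>
      le_antisymm ((hmax E hE).trans h0.symm.le) (nu_one_nonneg _)
    obtain ⟨Ω, hΩ⟩ := exists_isSupportProjection (isHermitian_extend_vonNeumann 1 ψ)
    obtain ⟨h1, h2⟩ := isOptimalStrategy_of_mul_eq_zero hU hδ hδ1 hψ h hΩ
    exact ⟨ψ, Ω, h1.1, h2.trans_le (sq_nonneg _)⟩
  · obtain ⟨a, b, hab⟩ := exists_isMostDistantPair (mul_mem hU hE₀.1)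
    obtain ⟨ρ₁, ρ₂, hρ⟩ := exists_isDiscriminatorPair hU hE₀ hmax hc hab
    obtain ⟨S, hS, hSS⟩ := exists_posSemidef_mul_self
      ((hρ.1.1.add hρ.2.1.1).smul (by simp : (0 : ℂ) ≤ 1 / 2))
    obtain ⟨Ω, hΩ⟩ := exists_isConditionalTest hU hδ hδ1 hE₀ hc hab hρ hS hSS
    exact ⟨_, _, isStrategy_labelledMeasurement hU hδ hδ1 hE₀ hc hab hρ hS hSS hΩ⟩

end QuantumCertification

theorem mainTheorem1 (d : ℕ) (hd : 2 ≤ d) (U : Matrix (Fin d) (Fin d) ℂ)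
    (hU : U ∈ Matrix.unitaryGroup (Fin d) ℂ) (δ : ℝ) (hδ : δ ∈ Set.Icc (0 : ℝ) 1) :
    -- every `ν_q(UE)`, with `q = √(1-δ)` or `q = 1`, is an attained minimum
    (∀ E ∈ diagonalUnitaries (Fin d), ∀ q : ℝ, q = Real.sqrt (1 - δ) ∨ q = 1 →
      IsLeast ((fun z : ℂ => ‖z‖) '' qNumericalRange (q : ℂ) (U * E)) (nu (q : ℂ) (U * E))) ∧
    -- `p_II` is an attained minimum
    IsLeast (achievableErrors (vonNeumann (1 : Matrix (Fin d) (Fin d) ℂ)) (vonNeumann U) δ)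
      (minTypeII (vonNeumann (1 : Matrix (Fin d) (Fin d) ℂ)) (vonNeumann U) δ) ∧
    -- `p_II = max_E ν²_{√(1-δ)}(UE)`
    IsGreatest ((fun E => nu ((Real.sqrt (1 - δ) : ℝ) : ℂ) (U * E) ^ 2) ''
        diagonalUnitaries (Fin d))
      (minTypeII (vonNeumann (1 : Matrix (Fin d) (Fin d) ℂ)) (vonNeumann U) δ) ∧
    -- an optimal strategy if `max_E ν(UE) = 0`
    ((∀ E ∈ diagonalUnitaries (Fin d), nu 1 (U * E) = 0) →
      (∃ ψ : Fin d × Fin d → ℂ, IsUnitVec ψ ∧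
        extend (vonNeumann 1) (proj ψ) * extend (vonNeumann U) (proj ψ) = 0) ∧
      ∀ ψ : Fin d × Fin d → ℂ, IsUnitVec ψ →
        extend (vonNeumann 1) (proj ψ) * extend (vonNeumann U) (proj ψ) = 0 →
        ∀ Ω : Matrix (Fin d × Fin d) (Fin d × Fin d) ℂ,
          IsSupportProjection (extend (vonNeumann 1) (proj ψ)) Ω →
          IsOptimalStrategy (vonNeumann 1) (vonNeumann U) δ ψ Ω) ∧
    -- an optimal strategy if `max_E ν(UE) > 0`
    (∀ E₀ ∈ diagonalUnitaries (Fin d),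
      (∀ E ∈ diagonalUnitaries (Fin d), nu 1 (U * E) ≤ nu 1 (U * E₀)) →
      0 < nu 1 (U * E₀) →
      ∀ a b : ℂ, IsMostDistantPair (U * E₀) a b →
        (∃ ρ₁ ρ₂ : Matrix (Fin d) (Fin d) ℂ, IsDiscriminatorPair (U * E₀) a b ρ₁ ρ₂) ∧
        ∀ ρ₁ ρ₂ : Matrix (Fin d) (Fin d) ℂ, IsDiscriminatorPair (U * E₀) a b ρ₁ ρ₂ →
          ∀ S : Matrix (Fin d) (Fin d) ℂ, S.PosSemidef → S * S = (1 / 2 : ℂ) • (ρ₁ + ρ₂) →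
            (∃ Ω : Fin d → Matrix (Fin d) (Fin d) ℂ,
              IsConditionalTest U δ ((1 / 2 : ℂ) • (ρ₁ + ρ₂)) S Ω) ∧
            ∀ Ω : Fin d → Matrix (Fin d) (Fin d) ℂ,
              IsConditionalTest U δ ((1 / 2 : ℂ) • (ρ₁ + ρ₂)) S Ω →
              IsOptimalStrategy (vonNeumann 1) (vonNeumann U) δ (inputState S)
                (labelledMeasurement Ω)) := by
  have hδ0 : 0 ≤ δ := hδ.1
  have hδ1 : δ ≤ 1 := hδ.2
  have : Nontrivial (Fin d) := Fin.nontrivial_iff_two_le.2 hd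
  have hq0 : 0 ≤ √(1 - δ) := Real.sqrt_nonneg _
  have hq1 : √(1 - δ) ≤ 1 := Real.sqrt_le_one.2 (by linarith)
  have hleast : ∀ E₀ ∈ diagonalUnitaries (Fin d),
      (∀ E ∈ diagonalUnitaries (Fin d), nu 1 (U * E) ≤ nu 1 (U * E₀)) →
      IsLeast (achievableErrors (vonNeumann (1 : Matrix (Fin d) (Fin d) ℂ)) (vonNeumann U) δ)
        (tradeoff √(1 - δ) (nu 1 (U * E₀)) ^ 2) := by
    intro E₀ hE₀ hmax
    have hlow : tradeoff √(1 - δ) (nu 1 (U * E₀)) ^ 2 ∈ lowerBounds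
        (achievableErrors (vonNeumann (1 : Matrix (Fin d) (Fin d) ℂ)) (vonNeumann U) δ) := by
      rintro p ⟨k, ψ, Ω, hs, rfl⟩
      exact tradeoff_sq_le_typeIIError hU hE₀ hδ1 hs
    obtain ⟨ψ, Ω, hs, hle⟩ := exists_isStrategy_typeIIError_le hU hδ0 hδ1 hE₀ hmax
    have hmem : typeIIError (vonNeumann U) ψ Ω ∈
        achievableErrors (vonNeumann (1 : Matrix (Fin d) (Fin d) ℂ)) (vonNeumann U) δ :=
      ⟨d, ψ, Ω, hs, rfl⟩
    exact ⟨le_antisymm hle (hlow hmem) ▸ hmem, hlow⟩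
  obtain ⟨E₁, hE₁, hmax₁⟩ := exists_isMax_nu_one U
  have hval : minTypeII (vonNeumann (1 : Matrix (Fin d) (Fin d) ℂ)) (vonNeumann U) δ =
      tradeoff √(1 - δ) (nu 1 (U * E₁)) ^ 2 := (hleast E₁ hE₁ hmax₁).csInf_eq
  refine ⟨?_, ?_, ?_, ?_, ?_⟩
  · intro E hE q hq
    have hq01 : 0 ≤ q ∧ q ≤ 1 := by
      rcases hq with rfl | rfl
      · exact ⟨hq0, hq1⟩
      · exact ⟨zero_le_one, le_rfl⟩
    have hV := mul_mem hU hE.1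
    rw [nu_eq_tradeoff hV hq01.1 hq01.2]
    exact isLeast_tradeoff_nu hV hq01.1 hq01.2
  · rw [hval]
    exact hleast E₁ hE₁ hmax₁
  · rw [hval]
    constructor
    · refine ⟨E₁, hE₁, ?_⟩
      simp only []
      rw [nu_eq_tradeoff (mul_mem hU hE₁.1) hq0 hq1]
    · rintro _ ⟨E, hE, rfl⟩
      simp only []
      rw [nu_eq_tradeoff (mul_mem hU hE.1) hq0 hq1]
      have := tradeoff_mono hq0 (nu_one_nonneg _) (hmax₁ E hE)
      gcongr
      exact tradeoff_nonneg _ _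
  · intro h
    refine ⟨exists_isUnitVec_extend_mul_eq_zero hU h, fun ψ hψ hmul Ω hΩ => ?_⟩
    exact (isOptimalStrategy_of_mul_eq_zero hU hδ0 hδ1 hψ hmul hΩ).1
  · intro E₀ hE₀ hmax hc a b hab
    refine ⟨exists_isDiscriminatorPair hU hE₀ hmax hc hab, fun ρ₁ ρ₂ hρ S hS hSS => ?_⟩
    refine ⟨exists_isConditionalTest hU hδ0 hδ1 hE₀ hc hab hρ hS hSS, fun Ω hΩ => ?_⟩
    obtain ⟨hs, hle⟩ := isStrategy_labelledMeasurement hU hδ0 hδ1 hE₀ hc hab hρ hS hSS hΩ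
    exact ⟨hs, fun p hp => hle.trans ((hleast E₀ hE₀ hmax).2 hp)⟩
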